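/- Let $s\ge 1$ and $r\ge 0$ be integers and $k=s+r$. For $j=1,\dots,s$ let $P_j(x)=\sqrt{2j-1}\,\hat P_{j-1}(x)$, where $\hat P_{n}$ is the shifted Legendre polynomial of degree $n$ on $[0,1]$ (with $\hat P_n(1)=1$), so that $\int_0^1P_i(x)P_j(x)\,\mathrm{d}x=\delta_{ij}$. Let $c_1,\dots,c_s$ (the fundamental abscissae) and $\hat c_1,\dots,\hat c_r$ (the silent abscissae) be real numbers, let $(\tau_1,\dots,\tau_k)=(c_1,\dots,c_s,\hat c_1,\dots,\hat c_r)$, and let $\omega_1,\dots,\omega_k$ be real weights. Define the matrices ${\cal I}_s,{\cal P}_s\in\mathbb R^{k\times s}$ and $\Omega\in\mathbb R^{k\times k}$ by $$({\cal I}_s)_{ij}=\int_0^{\tau_i}P_j(x)\,\mathrm{d}x,\qquad ({\cal P}_s)_{ij}=P_j(\tau_i),\qquad \Omega=\mathrm{diag}(\omega_1,\dots,\omega_k).$$ HBVM$(k,s)$ is the $k$-stage Runge–Kutta method with matrix $A={\cal I}_s{\cal P}_s^T\Omega$, weights $\omega_1,\dots,\omega_k$ and abscissae $\tau_1,\dots,\tau_k$.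 Suppose that the quadrature $\sum_{i=1}^k\omega_i\,g(\tau_i)$ for $\int_0^1g(x)\,\mathrm{d}x$ has order at least $2s$, that is, it is exact for all real polynomials $g$ of degree at most $2s-1$. Then HBVM$(k,s)$ has order exactly $p=2s$, whatever the choice of the abscissae $c_1,\dots,c_s$. Here a Runge–Kutta method with matrix $(a_{ij})$, weights $b_i$ and abscissae $\tau_i$ has order at least $p$ if the following holds for every $m$, every initial value problem $\dot y=f(t,y)$, $y(t_0)=y_0\in\mathbb R^m$, with $f$ of class $C^p$ in a neighbourhood of $(t_0,y_0)$, and every exact solution $y$ on an interval $[t_0,t_0+T]$, $T>0$: there are $\delta,h_0>0$ and $K$ such that for all $0<h\le h_0$ the stage equations $Y_i=y_0+h\sum_ja_{ij}f(t_0+\tau_jh,Y_j)$, $i=1,\dots,k$, have exactly one solution with all $Y_i$ in the open ball of radius $\delta$ around $y_0$, and $y_1=y_0+h\sum_ib_if(t_0+\tau_ih,Y_i)$ satisfies $\|y_1-y(t_0+h)\|\le Kh^{p+1}$. It has order exactly $p$ if $p$ is the largest integer such that it has order at least $p$. -/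

import Mathlib

open Polynomial Set

noncomputable section

/-- A `k`-stage Runge–Kutta method, given by its Butcher tableau: the matrix `A`, the weights `b`
and the abscissae `c`. -/
structure RungeKutta (k : ℕ) where
  A : Matrix (Fin k) (Fin k) ℝ
  b : Fin k → ℝ
  c : Fin k → ℝ

namespace RungeKutta

variable {k : ℕ} {E : Type*} [NormedAddCommGroup E] [NormedSpace ℝ E]

/-- `Y` solves the stage equations
`Y i = y₀ + h ∑ j, a i j • f (t₀ + c j h) (Y j)` of the step of length `h` from `(t₀, y₀)`,
for the problem `y' = f t y`. -/
def IsStages (M : RungeKutta k) (f : ℝ → E → E) (t₀ : ℝ) (y₀ : E) (h : ℝ) (Y : Fin k → E) :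
    Prop :=
  ∀ i, Y i = y₀ + h • ∑ j, M.A i j • f (t₀ + M.c j * h) (Y j)

/-- The new approximation `y₁ = y₀ + h ∑ i, b i • f (t₀ + c i h) (Y i)` produced from the
stages `Y`. -/
def step (M : RungeKutta k) (f : ℝ → E → E) (t₀ : ℝ) (y₀ : E) (h : ℝ) (Y : Fin k → E) : E :=
  y₀ + h • ∑ i, M.b i • f (t₀ + M.c i * h) (Y i)

/-- The method has order at least `p`: for every initial value problem `y' = f t y`, `y t₀ = y₀`
in `ℝᵐ` with `f` of class `C^p` near `(t₀, y₀)`, and every exact solution `y` on a nontrivial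
interval `[t₀, t₀ + T]`, the method is well defined for all small step lengths `h > 0` (the stage
equations have exactly one solution in a fixed ball around `y₀`), and its local error
`y₁ - y (t₀ + h)` is bounded by `K h ^ (p + 1)`. -/
def OrderAtLeast (M : RungeKutta k) (p : ℕ) : Prop :=
  ∀ (m : ℕ) (f : ℝ → EuclideanSpace ℝ (Fin m) → EuclideanSpace ℝ (Fin m))
    (t₀ : ℝ) (y₀ : EuclideanSpace ℝ (Fin m)),
    ContDiffAt ℝ p (Function.uncurry f) (t₀, y₀) →
    ∀ (T : ℝ) (y : ℝ → EuclideanSpace ℝ (Fin m)), 0 < T → y t₀ = y₀ →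
      (∀ t ∈ Icc t₀ (t₀ + T), HasDerivWithinAt y (f t (y t)) (Icc t₀ (t₀ + T)) t) →
      ∃ δ > 0, ∃ h₀ > 0, ∃ K : ℝ, ∀ h ∈ Ioc 0 h₀,
        (∃! Y : Fin k → EuclideanSpace ℝ (Fin m),
          (∀ i, Y i ∈ Metric.ball y₀ δ) ∧ M.IsStages f t₀ y₀ h Y) ∧
        ∀ Y : Fin k → EuclideanSpace ℝ (Fin m),
          (∀ i, Y i ∈ Metric.ball y₀ δ) → M.IsStages f t₀ y₀ h Y →
            ‖M.step f t₀ y₀ h Y - y (t₀ + h)‖ ≤ K * h ^ (p + 1)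

/-- The method has order (exactly) `p`. -/
def HasOrder (M : RungeKutta k) (p : ℕ) : Prop :=
  IsGreatest {q : ℕ | M.OrderAtLeast q} p

end RungeKutta

/-- The quadrature `∑ i, ω i * g (τ i)` for `∫₀¹ g` has order at least `q`: it is exact for all
polynomials of degree at most `q - 1`. -/
def QuadratureOrderAtLeast {k : ℕ} (τ ω : Fin k → ℝ) (q : ℕ) : Prop :=
  ∀ g : ℝ[X], g.degree < q → ∑ i, ω i * g.eval (τ i) = ∫ x in (0 : ℝ)..1, g.eval x

namespace HBVM

/-- The orthonormal shifted Legendre polynomial of degree `n` on `[0, 1]`, with positive leading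
coefficient. (Mathlib's `shiftedLegendre n` takes the value `1` at `0`, and so differs by the sign
`(-1) ^ n` from the usual normalization, value `1` at `1`.) With indices starting from `1`, as is
usual for these methods, this is `P_{n+1} = √(2n+1) * P̂_n`. -/
def P (n : ℕ) : ℝ[X] :=
  C ((-1) ^ n * √(2 * n + 1)) * (shiftedLegendre n).map (Int.castRingHom ℝ)

/-- The `k × s` matrix with entries `∫₀^{τ i} P j`. -/
def integralMatrix {k : ℕ} (s : ℕ) (τ : Fin k → ℝ) : Matrix (Fin k) (Fin s) ℝ :=
  Matrix.of fun i j => ∫ x in (0 : ℝ)..τ i, (P j).eval x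

/-- The `k × s` matrix with entries `P j (τ i)`. -/
def valueMatrix {k : ℕ} (s : ℕ) (τ : Fin k → ℝ) : Matrix (Fin k) (Fin s) ℝ :=
  Matrix.of fun i j => (P j).eval (τ i)

/-- HBVM(k,s) with nodes `τ` and weights `ω`, as the Runge–Kutta method with tableau
`A = I_s P_sᵀ Ω`, weights `ω` and abscissae `τ`. -/
def method {k : ℕ} (s : ℕ) (τ ω : Fin k → ℝ) : RungeKutta k where
  A := integralMatrix s τ * (valueMatrix s τ).transpose * Matrix.diagonal ω
  b := ω
  c := τ

end HBVM

end

/-! Write σ for the second component of `path`: the polynomial with σ(0) = y₀ and σ' = h ∑_{j<s} γ_j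
P_j, where γ_j are the discrete Legendre coefficients of f along σ. The factorization of the tableau
says that the stages are the values of σ at the nodes, and since ∫₀¹ P_j = 0 for j ≥ 1 the new
approximation is σ(1) (`exists_isCollocation_of_isStages`). It remains to compare σ(1) with u(1),
where u(x) = y(t₀ + xh).

Order at least 2s (`exists_norm_error_le`). A bootstrap gives γ_j = O(h^j), hence the i-th
derivative of f along σ is O(h^i). Exactness of the quadrature and a Peano type bound then control
the defect d = ∑ γ_j P_j - f(σ): pointwise d = O(h^s), while its moments satisfy ∫₀¹ x^j d =
O(h^(2s-j)) for j < s. The pointwise bound alone gives only e = σ - u = O(h^(s+1)). For the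
endpoint, e is multiplied by an operator valued polynomial w = ∑_{i<s} x^i W_i with W_i = O(h^i),
which solves the adjoint equation w' = -h w ∂_y f(σ) up to O(h^s). Then (w e)' consists of residual
times e, of size O(h^(2s+1)), of a quadratic remainder O(h^(2s+3)), and of h w d, whose integral is
O(h^(2s+1)) by the moment bounds. As w(1) = 1 + O(h), the bound passes to e(1). A cutoff makes f
globally smooth with compact support, and the stage equations are solved by contraction.

Order not larger (`sum_method_ne`). For y₀' = t^s, y₁' = t^(s-1) y₀ every quadrature in the step has
integrand of degree at most 2s-1, so the error constant is ∫₀¹ x^(s-1) (Q - x^(s+1)/(s+1)), with Q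
the antiderivative of the projection of x^s to degree below s. By parts it is 1/s times the squared
norm of x^s minus that projection, which is positive. -/

noncomputable section

/-! ### Integration of polynomials over [0, 1]. -/

/-- Integration over `[0, 1]` as a linear functional on real polynomials. -/
def polyIntegral : ℝ[X] →ₗ[ℝ] ℝ where
  toFun p := ∫ x in (0 : ℝ)..1, p.eval x
  map_add' p q := by
    simp only [eval_add]
    exact intervalIntegral.integral_add (p.continuous.intervalIntegrable _ _)
      (q.continuous.intervalIntegrable _ _)
  map_smul' a p := by simp

lemma polyIntegral_apply (p : ℝ[X]) : polyIntegral p = ∫ x in (0 : ℝ)..1, p.eval x := rfl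

lemma polyIntegral_C_mul (a : ℝ) (p : ℝ[X]) : polyIntegral (C a * p) = a * polyIntegral p := by
  rw [← smul_eq_C_mul, map_smul, smul_eq_mul]

lemma polyIntegral_derivative (p : ℝ[X]) :
    polyIntegral (derivative p) = p.eval 1 - p.eval 0 :=
  intervalIntegral.integral_eq_sub_of_hasDerivAt (fun x _ => p.hasDerivAt x)
    (p.derivative.continuous.intervalIntegrable _ _)

lemma polyIntegral_derivative_mul {u : ℝ[X]} (h0 : u.eval 0 = 0) (h1 : u.eval 1 = 0) (q : ℝ[X]) :
    polyIntegral (derivative u * q) = -polyIntegral (u * derivative q) := by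
  have h := polyIntegral_derivative (u * q)
  rw [derivative_mul, map_add] at h
  simp only [eval_mul, h0, h1] at h
  linarith

lemma polyIntegral_iterate_derivative_mul {n : ℕ} {u : ℝ[X]}
    (h0 : ∀ i < n, (derivative^[i] u).eval 0 = 0) (h1 : ∀ i < n, (derivative^[i] u).eval 1 = 0)
    (q : ℝ[X]) :
    polyIntegral (derivative^[n] u * q) = (-1) ^ n * polyIntegral (u * derivative^[n] q) := by
  induction n generalizing q with
  | zero => simp
  | succ n ih =>
    rw [Function.iterate_succ_apply',
      polyIntegral_derivative_mul (h0 n n.lt_succ_self) (h1 n n.lt_succ_self),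
      ih (fun i hi => h0 i (by omega)) (fun i hi => h1 i (by omega)), ← Function.iterate_succ_apply]
    ring

/-- The Beta integral. Integration by parts lowers the exponent of `1 - X` and raises that of `X`,
so the induction on `n` must run over all `m`. -/
lemma polyIntegral_X_pow_mul_one_sub_X_pow (m n : ℕ) :
    polyIntegral (X ^ m * (1 - X) ^ n) * ((m + n + 1).factorial : ℝ) =
      m.factorial * n.factorial := by
  induction n generalizing m with
  | zero =>
    have : (m : ℝ) + 1 ≠ 0 := by positivity
    rw [polyIntegral_apply]
    simp [Nat.factorial_succ]
    field_simp
  | succ n ih =>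
    have hm : (m : ℝ) + 1 ≠ 0 := by positivity
    have h := polyIntegral_derivative (X ^ (m + 1) * (1 - X) ^ (n + 1) : ℝ[X])
    have e : derivative (X ^ (m + 1) * (1 - X) ^ (n + 1) : ℝ[X]) =
        C ((m : ℝ) + 1) * (X ^ m * (1 - X) ^ (n + 1)) -
          C ((n : ℝ) + 1) * (X ^ (m + 1) * (1 - X) ^ n) := by
      simp [derivative_mul, derivative_pow]
      ring
    rw [e, map_sub, polyIntegral_C_mul, polyIntegral_C_mul] at h
    simp only [eval_mul, eval_pow, eval_X, eval_sub, eval_one, sub_self, sub_zero,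
      zero_pow (Nat.succ_ne_zero _), mul_zero, zero_mul] at h
    have h2 := ih (m + 1)
    rw [show m + 1 + n + 1 = m + (n + 1) + 1 by ring] at h2
    rw [Nat.factorial_succ m] at h2
    rw [Nat.factorial_succ n]
    push_cast at h2 ⊢
    apply mul_left_cancel₀ hm
    linear_combination ((m + (n + 1) + 1).factorial : ℝ) * h + ((n : ℝ) + 1) * h2

/-! ### Orthonormality of the shifted Legendre polynomials. -/

namespace HBVM

/-- Rodrigues' formula. -/
lemma factorial_mul_P (n : ℕ) :
    C (n.factorial : ℝ) * P n =
      C ((-1) ^ n * √(2 * n + 1)) * derivative^[n] (X ^ n * (1 - X) ^ n : ℝ[X]) := by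
  have h := congrArg (Polynomial.map (Int.castRingHom ℝ)) (factorial_mul_shiftedLegendre_eq n)
  rw [Polynomial.map_mul, ← iterate_derivative_map] at h
  simp only [Polynomial.map_mul, Polynomial.map_pow, Polynomial.map_sub, Polynomial.map_one,
    map_X, Polynomial.map_natCast] at h
  rw [← h, P, ← C_eq_natCast]
  ring

lemma natDegree_P (n : ℕ) : (P n).natDegree = n := by
  rw [P, natDegree_C_mul, natDegree_map_eq_of_injective (RingHom.injective_int _),
    natDegree_shiftedLegendre]
  have : (0 : ℝ) < 2 * n + 1 := by positivity
  simp [(Real.sqrt_pos.2 this).ne']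

lemma degree_P (n : ℕ) : (P n).degree = n := by
  rw [P, degree_C_mul, degree_map_eq_of_injective (RingHom.injective_int _),
    degree_shiftedLegendre]
  have : (0 : ℝ) < 2 * n + 1 := by positivity
  simp [(Real.sqrt_pos.2 this).ne']

lemma P_zero : P 0 = 1 := by
  simp [P, shiftedLegendre]

lemma coeff_P_self (n : ℕ) :
    (P n).coeff n = √(2 * n + 1) * ((n + n).choose n : ℝ) := by
  rw [P, coeff_C_mul, coeff_map, coeff_shiftedLegendre]
  simp only [eq_intCast, Int.cast_mul, Int.cast_pow, Int.cast_neg, Int.cast_one, Int.cast_natCast,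
    Nat.choose_self, Nat.cast_one, mul_one]
  have : ((-1 : ℝ) ^ n) * (-1) ^ n = 1 := by rw [← mul_pow]; simp
  linear_combination (√(2 * n + 1) * ((n + n).choose n : ℝ)) * this

/-- Rodrigues' formula integrated by parts `n` times: 0 and 1 are `n`-fold roots of `X ^ n * (1 - X)
^ n`, so there are no boundary terms, and the two signs `(-1) ^ n` cancel. -/
lemma factorial_mul_polyIntegral_P_mul (n : ℕ) (q : ℝ[X]) :
    (n.factorial : ℝ) * polyIntegral (P n * q) =
      √(2 * n + 1) * polyIntegral ((X ^ n * (1 - X) ^ n) * derivative^[n] q) := by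
  have hd (a : ℝ) (ha : (X - C a) ^ n ∣ (X ^ n * (1 - X) ^ n : ℝ[X])) (i : ℕ) (hi : i < n) :
      (derivative^[i] (X ^ n * (1 - X) ^ n : ℝ[X])).eval a = 0 := by
    have h := pow_sub_dvd_iterate_derivative_of_pow_dvd i ha
    exact dvd_iff_isRoot.1 ((dvd_pow_self _ (by omega)).trans h)
  have h0 := hd 0 (by simp)
  have h1 := hd 1 (by
    refine Dvd.dvd.mul_left (pow_dvd_pow_of_dvd ⟨-1, ?_⟩ n) _
    simp)
  rw [← polyIntegral_C_mul, ← mul_assoc, factorial_mul_P, mul_assoc, polyIntegral_C_mul,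
    polyIntegral_iterate_derivative_mul h0 h1]
  have : ((-1 : ℝ) ^ n) * (-1) ^ n = 1 := by rw [← mul_pow]; simp
  linear_combination (√(2 * n + 1) *
    polyIntegral ((X ^ n * (1 - X) ^ n) * derivative^[n] q)) * this

lemma polyIntegral_P_mul_of_degree_lt {n : ℕ} {q : ℝ[X]} (hq : q.degree < n) :
    polyIntegral (P n * q) = 0 := by
  have h := factorial_mul_polyIntegral_P_mul n q
  rw [iterate_derivative_eq_zero_of_degree_lt hq, mul_zero, map_zero, mul_zero] at h
  exact (mul_eq_zero.1 h).resolve_left (by positivity)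

lemma polyIntegral_P_mul_self (n : ℕ) : polyIntegral (P n * P n) = 1 := by
  have h := factorial_mul_polyIntegral_P_mul n (P n)
  have hd : derivative^[n] (P n) = C (n.factorial * (P n).coeff n) := by
    have h0 : (derivative^[n] (P n)).natDegree = 0 := by
      have := natDegree_iterate_derivative (P n) n
      rw [natDegree_P] at this
      omega
    rw [eq_C_of_natDegree_eq_zero h0, coeff_iterate_derivative]
    simp [Nat.descFactorial_self]
  rw [hd, mul_comm _ (C _), polyIntegral_C_mul, coeff_P_self] at h
  have hb := polyIntegral_X_pow_mul_one_sub_X_pow n n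
  have hc : ((n + n).choose n : ℝ) * (n.factorial * n.factorial) = (n + n).factorial := by
    rw [← mul_assoc]; exact_mod_cast Nat.add_choose_mul_factorial_mul_factorial n n
  have hs : √(2 * (n : ℝ) + 1) * √(2 * n + 1) = 2 * n + 1 := Real.mul_self_sqrt (by positivity)
  rw [Nat.factorial_succ] at hb
  push_cast at hb
  have hf : (n.factorial : ℝ) ≠ 0 := by positivity
  have hf2 : ((n + n).factorial : ℝ) ≠ 0 := by positivity
  apply mul_left_cancel₀ hf
  apply mul_left_cancel₀ hf2
  rw [h]
  linear_combination (n.factorial : ℝ) * ((n + n).choose n : ℝ) * hb + n.factorial * hc +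
    (n.factorial : ℝ) * ((n + n).choose n : ℝ) * (n + n).factorial *
      polyIntegral (X ^ n * (1 - X) ^ n) * hs

lemma polyIntegral_P_mul_P_of_ne {i j : ℕ} (h : i ≠ j) : polyIntegral (P i * P j) = 0 := by
  rcases lt_or_gt_of_ne h with h | h
  · rw [mul_comm]
    exact polyIntegral_P_mul_of_degree_lt (by rw [degree_P]; exact_mod_cast h)
  · exact polyIntegral_P_mul_of_degree_lt (by rw [degree_P]; exact_mod_cast h)

lemma eq_zero_of_polyIntegral_P_mul {s : ℕ} {r : ℝ[X]} (hr : r.degree < s)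
    (h : ∀ j < s, polyIntegral (P j * r) = 0) : r = 0 := by
  by_contra h0
  set d := r.natDegree with hd
  have hds : d < s := (natDegree_lt_iff_degree_lt h0).2 hr
  have hP0 : (P d).coeff d ≠ 0 := by
    have := leadingCoeff_ne_zero.2 (show P d ≠ 0 from fun h => by simpa [h] using degree_P d)
    rwa [leadingCoeff, natDegree_P] at this
  -- With `d` the degree of `r`, the leading terms cancel, so this combination is orthogonal to `P
  -- d`; as `r` is too, its leading coefficient vanishes.
  have hlt : (P d * C (r.coeff d) - r * C ((P d).coeff d)).degree < d := by
    rw [degree_lt_iff_coeff_zero]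
    intro m hm
    rw [coeff_sub, coeff_mul_C, coeff_mul_C]
    rcases eq_or_lt_of_le hm with rfl | hm
    · ring
    · rw [coeff_eq_zero_of_natDegree_lt (by rwa [natDegree_P]),
        coeff_eq_zero_of_natDegree_lt (p := r) hm]
      ring
  have h1 := polyIntegral_P_mul_of_degree_lt hlt
  rw [show P d * (P d * C (r.coeff d) - r * C ((P d).coeff d)) =
    C (r.coeff d) * (P d * P d) - C ((P d).coeff d) * (P d * r) by ring, map_sub,
    polyIntegral_C_mul, polyIntegral_C_mul, polyIntegral_P_mul_self, h d hds] at h1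
  have : r.leadingCoeff = 0 := by simpa [leadingCoeff, ← hd] using h1
  exact h0 (leadingCoeff_eq_zero.1 this)

lemma polyIntegral_P_mul_sum {s j : ℕ} (hj : j < s) (a : ℕ → ℝ) :
    polyIntegral (P j * ∑ i ∈ Finset.range s, C (a i) * P i) = a j := by
  rw [Finset.mul_sum, map_sum, Finset.sum_eq_single_of_mem j (Finset.mem_range.2 hj)]
  · rw [mul_left_comm, polyIntegral_C_mul, polyIntegral_P_mul_self, mul_one]
  · intro i _ hi
    rw [mul_left_comm, polyIntegral_C_mul, polyIntegral_P_mul_P_of_ne hi.symm, mul_zero]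

/-- The Legendre expansion of a polynomial of degree less than `s`. -/
lemma sum_polyIntegral_P_mul {s : ℕ} {q : ℝ[X]} (hq : q.degree < s) :
    ∑ j ∈ Finset.range s, C (polyIntegral (P j * q)) * P j = q := by
  rw [← sub_eq_zero]
  apply eq_zero_of_polyIntegral_P_mul (s := s)
  · refine (degree_sub_le _ _).trans_lt (max_lt ?_ hq)
    rw [← mem_degreeLT]
    refine Submodule.sum_mem _ fun j hj => ?_
    rw [← smul_eq_C_mul]
    refine Submodule.smul_mem _ _ (mem_degreeLT.2 ?_)
    rw [degree_P]
    exact_mod_cast Finset.mem_range.1 hj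
  · intro j hj
    rw [mul_sub, map_sub, polyIntegral_P_mul_sum hj, sub_self]

lemma polyIntegral_P (j : ℕ) : polyIntegral (P j) = if j = 0 then 1 else 0 := by
  split_ifs with h
  · subst h
    simpa [P_zero] using polyIntegral_P_mul_self 0
  · simpa [P_zero] using polyIntegral_P_mul_P_of_ne h

end HBVM

/-! ### Polynomial antiderivatives and exact quadrature. -/

/-- The antiderivative of a real polynomial that vanishes at `0`. -/
def antiderivative (p : ℝ[X]) : ℝ[X] :=
  ∑ i ∈ Finset.range (p.natDegree + 1), C (p.coeff i / (i + 1)) * X ^ (i + 1)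

lemma derivative_antiderivative (p : ℝ[X]) : derivative (antiderivative p) = p := by
  conv_rhs => rw [p.as_sum_range_C_mul_X_pow]
  rw [antiderivative, derivative_sum]
  refine Finset.sum_congr rfl fun i _ => ?_
  have : (i : ℝ) + 1 ≠ 0 := by positivity
  rw [derivative_C_mul_X_pow]
  push_cast
  rw [div_mul_cancel₀ _ this]

lemma eval_zero_antiderivative (p : ℝ[X]) : (antiderivative p).eval 0 = 0 := by
  simp [antiderivative, eval_finsetSum]

lemma natDegree_antiderivative_le (p : ℝ[X]) :
    (antiderivative p).natDegree ≤ p.natDegree + 1 := by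
  refine natDegree_sum_le_of_forall_le _ _ fun i hi => ?_
  refine (natDegree_C_mul_X_pow_le _ _).trans ?_
  have := Finset.mem_range.1 hi
  omega

lemma eval_antiderivative (p : ℝ[X]) (x : ℝ) :
    (antiderivative p).eval x = ∫ u in (0 : ℝ)..x, p.eval u := by
  have h := intervalIntegral.integral_eq_sub_of_hasDerivAt (a := 0) (b := x)
    (fun u _ => (antiderivative p).hasDerivAt u)
    ((antiderivative p).derivative.continuous.intervalIntegrable _ _)
  rw [derivative_antiderivative, eval_zero_antiderivative, sub_zero] at h
  exact h.symm

section Quadrature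

variable {k N : ℕ} {τ ω : Fin k → ℝ} (hω : QuadratureOrderAtLeast τ ω N)
include hω

lemma QuadratureOrderAtLeast.sum_eval {g : ℝ[X]} (hg : g.natDegree < N) :
    ∑ l, ω l * g.eval (τ l) = polyIntegral g :=
  hω g (degree_le_natDegree.trans_lt (by exact_mod_cast hg))

end Quadrature

/-! ### Taylor remainders and functionals that vanish on polynomials. -/

section Taylor

variable {E : Type*} [NormedAddCommGroup E] [NormedSpace ℝ E]

lemma norm_sub_taylor_le {φ : ℝ → E} {n : ℕ} (hφ : ContDiff ℝ n φ) {a b K : ℝ} (hab : a < b)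
    (hK : ∀ x ∈ Icc a b, ‖iteratedDeriv n φ x‖ ≤ K) :
    ∀ x ∈ Icc a b, ‖φ x - ∑ i ∈ Finset.range n,
      (x - a) ^ i • ((i.factorial : ℝ)⁻¹ • iteratedDeriv i φ a)‖ ≤ K * (b - a) ^ n := by
  intro x hx
  have hw : ∀ i ≤ n, ∀ y ∈ Icc a b, iteratedDerivWithin i φ (Icc a b) y = iteratedDeriv i φ y := by
    intro i hi y hy
    exact iteratedDerivWithin_eq_iteratedDeriv (uniqueDiffOn_Icc hab)
      (hφ.of_le (by exact_mod_cast hi)).contDiffAt hy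
  have hK0 : 0 ≤ K := (norm_nonneg _).trans (hK x hx)
  rcases n with _ | n
  · simpa using hK x hx
  · have h := taylor_mean_remainder_bound (n := n) hab.le (f := φ)
      (by exact_mod_cast hφ.contDiffOn) hx (C := K)
      (fun y hy => by rw [hw _ le_rfl y hy]; exact hK y hy)
    rw [taylor_within_apply] at h
    have e : ∑ i ∈ Finset.range (n + 1), (((i.factorial : ℝ)⁻¹ * (x - a) ^ i) •
          iteratedDerivWithin i φ (Icc a b) a) =
        ∑ i ∈ Finset.range (n + 1), (x - a) ^ i • ((i.factorial : ℝ)⁻¹ • iteratedDeriv i φ a) := by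
      refine Finset.sum_congr rfl fun i hi => ?_
      rw [hw i (Finset.mem_range.1 hi).le a (left_mem_Icc.2 hab.le), smul_smul, mul_comm]
    rw [e] at h
    refine h.trans ?_
    have h1 : (x - a) ^ (n + 1) ≤ (b - a) ^ (n + 1) :=
      pow_le_pow_left₀ (by linarith [hx.1]) (by linarith [hx.2]) _
    have h2 : 0 ≤ (x - a) ^ (n + 1) := pow_nonneg (by linarith [hx.1]) _
    have h3 : (1 : ℝ) ≤ n.factorial := by exact_mod_cast n.factorial_pos
    calc _ ≤ K * (x - a) ^ (n + 1) / 1 := by gcongr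
      _ ≤ _ := by rw [div_one]; gcongr

/-- A Peano kernel type bound: a bounded functional that vanishes on the polynomials of degree
less than `n` is bounded by the `n`-th derivative. -/
lemma norm_le_of_vanishing {F : Type*} [NormedAddCommGroup F] {n : ℕ} {a b M : ℝ} (hab : a < b)
    (Λ : (ℝ → E) → F)
    (hsub : ∀ φ ψ, Continuous φ → Continuous ψ → Λ (fun x => φ x - ψ x) = Λ φ - Λ ψ)
    (hM : ∀ φ, Continuous φ → ∀ K, (∀ x ∈ Icc a b, ‖φ x‖ ≤ K) → ‖Λ φ‖ ≤ M * K)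
    (h0 : ∀ v : ℕ → E, Λ (fun x => ∑ i ∈ Finset.range n, (x - a) ^ i • v i) = 0)
    {φ : ℝ → E} (hφ : ContDiff ℝ n φ) {K : ℝ}
    (hK : ∀ x ∈ Icc a b, ‖iteratedDeriv n φ x‖ ≤ K) : ‖Λ φ‖ ≤ M * (b - a) ^ n * K := by
  set v : ℕ → E := fun i => (i.factorial : ℝ)⁻¹ • iteratedDeriv i φ a
  have hc : Continuous fun x : ℝ => ∑ i ∈ Finset.range n, (x - a) ^ i • v i := by fun_prop
  have h1 := hsub φ _ hφ.continuous hc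
  rw [h0, sub_zero] at h1
  rw [← h1]
  refine (hM _ (hφ.continuous.sub hc) _ (norm_sub_taylor_le hφ hab hK)).trans_eq ?_
  ring

end Taylor

lemma exists_norm_iteratedFDeriv_le {E F : Type*} [NormedAddCommGroup E] [NormedSpace ℝ E]
    [NormedAddCommGroup F] [NormedSpace ℝ F] {G : E → F} {n : ℕ} (hG : ContDiff ℝ n G)
    (hc : HasCompactSupport G) :
    ∃ C : ℝ, ∀ i ≤ n, ∀ x, ‖iteratedFDeriv ℝ i G x‖ ≤ C := by
  have h (i : ℕ) : ∃ C : ℝ, i ≤ n → ∀ x, ‖iteratedFDeriv ℝ i G x‖ ≤ C := by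
    by_cases hi : i ≤ n
    · obtain ⟨C, hC⟩ := (hc.iteratedFDeriv (𝕜 := ℝ) i).exists_bound_of_continuous
        (hG.continuous_iteratedFDeriv (by exact_mod_cast hi))
      exact ⟨C, fun _ => hC⟩
    · exact ⟨0, fun h => absurd h hi⟩
  choose C hC using h
  refine ⟨∑ i ∈ Finset.range (n + 1), |C i|, fun i hi x => (hC i hi x).trans ?_⟩
  exact (le_abs_self _).trans (Finset.single_le_sum (f := fun i => |C i|)
    (fun _ _ => abs_nonneg _) (Finset.mem_range.2 (by omega)))

lemma exists_abs_eval_le (p : ℝ[X]) (R : ℝ) : ∃ M : ℝ, 0 ≤ M ∧ ∀ x ∈ Icc (-R) R, |p.eval x| ≤ M := by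
  obtain ⟨M, hM⟩ := (isCompact_Icc (a := -R) (b := R)).exists_bound_of_continuousOn
    p.continuous.continuousOn
  exact ⟨max M 0, le_max_right _ _, fun x hx => (hM x hx).trans (le_max_left _ _)⟩

/-! ### Derivatives along the collocation curve. -/

namespace HBVM

variable {E : Type*} [NormedAddCommGroup E] [NormedSpace ℝ E]

/-- The polynomial with Legendre coefficients `γ`. -/
def legendreSum (s : ℕ) (γ : ℕ → E) (x : ℝ) : E :=
  ∑ j ∈ Finset.range s, (P j).eval x • γ j

/-- The curve `x ↦ (t₀ + x h, σ x)`, where `σ` is the polynomial with `σ 0 = y₀` whose derivative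
is `h` times the polynomial with Legendre coefficients `γ`. -/
def path (t₀ : ℝ) (y₀ : E) (s : ℕ) (γ : ℕ → E) (h x : ℝ) : ℝ × E :=
  (t₀ + x * h, y₀ + h • ∑ j ∈ Finset.range s, (antiderivative (P j)).eval x • γ j)

lemma iteratedDeriv_sum_eval_smul (n s : ℕ) (p : ℕ → ℝ[X]) (γ : ℕ → E) :
    iteratedDeriv n (fun x => ∑ j ∈ Finset.range s, (p j).eval x • γ j) =
      fun x => ∑ j ∈ Finset.range s, (derivative^[n] (p j)).eval x • γ j := by
  induction n with
  | zero => simp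
  | succ n ih =>
    rw [iteratedDeriv_succ, ih]
    ext x
    refine HasDerivAt.deriv ?_
    refine HasDerivAt.fun_sum fun j _ => ?_
    rw [Function.iterate_succ_apply']
    exact (Polynomial.hasDerivAt _ x).smul_const (γ j)

lemma hasDerivAt_path_snd (t₀ : ℝ) (y₀ : E) (s : ℕ) (γ : ℕ → E) (h x : ℝ) :
    HasDerivAt (fun x => (path t₀ y₀ s γ h x).2) (h • legendreSum s γ x) x := by
  refine (HasDerivAt.const_smul h (HasDerivAt.fun_sum fun j _ => ?_)).const_add y₀
  have := (Polynomial.hasDerivAt (antiderivative (P j)) x).smul_const (γ j)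
  rwa [derivative_antiderivative] at this

lemma contDiff_path (t₀ : ℝ) (y₀ : E) (s : ℕ) (γ : ℕ → E) (h : ℝ) {n : WithTop ℕ∞} :
    ContDiff ℝ n (path t₀ y₀ s γ h) := by
  unfold path
  refine (contDiff_const.add (contDiff_id.mul contDiff_const)).prodMk ?_
  refine contDiff_const.add (contDiff_const.smul (ContDiff.sum fun j _ => ?_))
  refine ContDiff.smul ?_ contDiff_const
  simpa using (antiderivative (P j)).contDiff_aeval (𝕜 := ℝ) n

lemma continuous_legendreSum (s : ℕ) (γ : ℕ → E) : Continuous (legendreSum s γ) := by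
  unfold legendreSum
  exact continuous_finsetSum _ fun j _ => (P j).continuous.smul continuous_const

/-- The `n`-th derivative kills `P j` for `j < n`, so only coefficients with `n ≤ j` enter. The
bootstrap in `exists_norm_collocation_le_pow` rests on this. -/
lemma exists_norm_iteratedDeriv_legendreSum_le (s n : ℕ) (R : ℝ) :
    ∃ M : ℝ, 0 ≤ M ∧ ∀ (γ : ℕ → E) (K : ℝ), (∀ j, n ≤ j → j < s → ‖γ j‖ ≤ K) → 0 ≤ K →
      ∀ x ∈ Icc (-R) R, ‖iteratedDeriv n (legendreSum s γ) x‖ ≤ M * K := by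
  have h (j : ℕ) := exists_abs_eval_le (derivative^[n] (P j)) R
  choose M hM0 hM using h
  refine ⟨∑ j ∈ Finset.range s, M j, Finset.sum_nonneg fun j _ => hM0 j, ?_⟩
  intro γ K hγ hK x hx
  unfold legendreSum
  rw [iteratedDeriv_sum_eval_smul, Finset.sum_mul]
  refine (norm_sum_le _ _).trans (Finset.sum_le_sum fun j hj => ?_)
  rw [norm_smul, Real.norm_eq_abs]
  rcases lt_or_ge j n with hjn | hjn
  · rw [iterate_derivative_eq_zero (by rw [natDegree_P]; exact hjn)]
    simpa using mul_nonneg (hM0 j) hK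
  · exact mul_le_mul (hM j x hx) (hγ j hjn (Finset.mem_range.1 hj)) (norm_nonneg _) (hM0 j)

lemma norm_iteratedDeriv_affine_le (t₀ x : ℝ) {h : ℝ} (h0 : 0 ≤ h) (n : ℕ) :
    ‖iteratedDeriv (n + 1) (fun x : ℝ => t₀ + x * h) x‖ ≤ h ^ (n + 1) := by
  have hd : deriv (fun x : ℝ => t₀ + x * h) = fun _ => h := by
    ext x
    simp
  rw [iteratedDeriv_succ', hd, iteratedDeriv_const]
  split_ifs with hn
  · subst hn
    simp [abs_of_nonneg h0]
  · simpa using pow_nonneg h0 (n + 1)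

/-- The derivative of the curve carries a factor `h`, so coefficient bounds up to `h ^ m` control
derivatives up to order `m + 1`. The form `(D * h) ^ i` is the one that
`norm_iteratedFDeriv_comp_le` asks for. -/
lemma exists_norm_iteratedFDeriv_path_le (s m : ℕ) (R K : ℝ) (hK : 0 ≤ K) :
    ∃ D : ℝ, 0 ≤ D ∧ ∀ (t₀ : ℝ) (y₀ : E), ∀ h ∈ Ioc (0 : ℝ) 1, ∀ γ : ℕ → E,
      (∀ n ≤ m, ∀ j, n ≤ j → j < s → ‖γ j‖ ≤ K * h ^ n) →
      ∀ x ∈ Icc (-R) R, ∀ i, 1 ≤ i → i ≤ m + 1 →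
        ‖iteratedFDeriv ℝ i (path t₀ y₀ s γ h) x‖ ≤ (D * h) ^ i := by
  have hM (n : ℕ) := exists_norm_iteratedDeriv_legendreSum_le (E := E) s n R
  choose M hM0 hM using hM
  have hMK (n : ℕ) : 0 ≤ M n * K := mul_nonneg (hM0 n) hK
  -- The summand 1 makes `h ^ i ≤ (D * h) ^ i`, as the time component needs.
  set D : ℝ := 1 + ∑ n ∈ Finset.range (m + 1), M n * K
  have hD1 : 1 ≤ D := le_add_of_nonneg_right (Finset.sum_nonneg fun n _ => hMK n)
  refine ⟨D, by linarith, fun t₀ y₀ h hh γ hγ x hx i hi him => ?_⟩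
  obtain ⟨n, rfl⟩ : ∃ n, i = n + 1 := ⟨i - 1, by omega⟩
  have hnm : n ≤ m := by omega
  have hc := contDiff_path t₀ y₀ s γ h (n := ((n + 1 : ℕ) : WithTop ℕ∞))
  have hp : path t₀ y₀ s γ h = fun x => ((path t₀ y₀ s γ h x).1, (path t₀ y₀ s γ h x).2) := rfl
  rw [hp, iteratedFDeriv_prodMk hc.contDiffAt.fst hc.contDiffAt.snd le_rfl,
    ContinuousMultilinearMap.opNorm_prod, norm_iteratedFDeriv_eq_norm_iteratedDeriv,
    norm_iteratedFDeriv_eq_norm_iteratedDeriv]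
  have hDn : D ≤ D ^ (n + 1) := le_self_pow₀ hD1 (Nat.succ_ne_zero n)
  have hh0 : 0 ≤ h ^ (n + 1) := pow_nonneg hh.1.le _
  rw [mul_pow]
  refine max_le ?_ ?_
  · refine (norm_iteratedDeriv_affine_le t₀ x hh.1.le n).trans ?_
    exact le_mul_of_one_le_left hh0 (hD1.trans hDn)
  · have hd : deriv (fun x => (path t₀ y₀ s γ h x).2) = h • legendreSum s γ := by
      ext x
      exact (hasDerivAt_path_snd t₀ y₀ s γ h x).deriv
    have hcl : ContDiff ℝ n (legendreSum s γ) := by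
      unfold legendreSum
      refine ContDiff.sum fun j _ => ContDiff.smul ?_ contDiff_const
      simpa using (P j).contDiff_aeval (𝕜 := ℝ) n
    rw [iteratedDeriv_succ', hd, iteratedDeriv_const_smul hcl.contDiffAt, norm_smul,
      Real.norm_of_nonneg hh.1.le]
    have h1 := hM n γ (K * h ^ n) (hγ n hnm) (mul_nonneg hK (pow_nonneg hh.1.le n)) x hx
    have h2 : M n * K ≤ D := by
      have := Finset.single_le_sum (f := fun n => M n * K) (fun n _ => hMK n)
        (Finset.mem_range.2 (Nat.lt_succ_of_le hnm))
      simp only [D]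
      linarith
    calc h * ‖iteratedDeriv n (legendreSum s γ) x‖ ≤ h * (M n * (K * h ^ n)) := by
          gcongr
          exact hh.1.le
      _ = M n * K * h ^ (n + 1) := by ring
      _ ≤ D ^ (n + 1) * h ^ (n + 1) := by gcongr; exact h2.trans hDn

/-- Derivatives of a smooth function along the curve `path`. -/
lemma exists_norm_iteratedDeriv_comp_path_le {F : Type*} [NormedAddCommGroup F] [NormedSpace ℝ F]
    (s m N : ℕ) (R K C : ℝ) (hK : 0 ≤ K) :
    ∃ K' : ℝ, 0 ≤ K' ∧ ∀ (G : ℝ × E → F), ContDiff ℝ N G →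
      (∀ i ≤ N, ∀ p, ‖iteratedFDeriv ℝ i G p‖ ≤ C) →
      ∀ (t₀ : ℝ) (y₀ : E), ∀ h ∈ Ioc (0 : ℝ) 1, ∀ γ : ℕ → E,
      (∀ n ≤ m, ∀ j, n ≤ j → j < s → ‖γ j‖ ≤ K * h ^ n) →
      ∀ x ∈ Icc (-R) R, ∀ i ≤ m + 1, i ≤ N →
        ‖iteratedDeriv i (fun x => G (path t₀ y₀ s γ h x)) x‖ ≤ K' * h ^ i := by
  obtain ⟨D, hD0, hD⟩ := exists_norm_iteratedFDeriv_path_le (E := E) s m R K hK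
  have hpos (i : ℕ) : 0 ≤ (i.factorial : ℝ) * |C| * D ^ i := by positivity
  refine ⟨∑ i ∈ Finset.range (m + 2), (i.factorial : ℝ) * |C| * D ^ i,
    Finset.sum_nonneg fun i _ => hpos i, ?_⟩
  intro G hG hC t₀ y₀ h hh γ hγ x hx i him hiN
  rw [← norm_iteratedFDeriv_eq_norm_iteratedDeriv]
  have h1 := norm_iteratedFDeriv_comp_le (n := i) (N := N) hG (contDiff_path t₀ y₀ s γ h)
    (by exact_mod_cast hiN) x (C := |C|) (D := D * h)
    (fun l hl => (hC l (hl.trans hiN) _).trans (le_abs_self C))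
    (fun l hl hli => hD t₀ y₀ h hh γ hγ x hx l hl (hli.trans him))
  refine h1.trans ?_
  rw [mul_pow, ← mul_assoc]
  have := Finset.single_le_sum (f := fun i : ℕ => (i.factorial : ℝ) * |C| * D ^ i)
    (fun n _ => hpos n) (Finset.mem_range.2 (show i < m + 2 by omega))
  exact mul_le_mul_of_nonneg_right this (pow_nonneg hh.1.le _)

end HBVM

/-! ### Discrete Legendre coefficients and quadrature error estimates. -/

namespace HBVM

variable {E : Type*} [NormedAddCommGroup E] [NormedSpace ℝ E] {k : ℕ}

/-- The discrete Legendre coefficients of `φ` with respect to the quadrature with nodes `τ` and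
weights `ω`. -/
def coeffs (τ ω : Fin k → ℝ) (φ : ℝ → E) (j : ℕ) : E :=
  ∑ l, (ω l * (P j).eval (τ l)) • φ (τ l)

/-- `γ` consists of the discrete Legendre coefficients of `G` along the curve defined by `γ`. -/
def IsCollocation (τ ω : Fin k → ℝ) (G : ℝ × E → E) (t₀ : ℝ) (y₀ : E) (s : ℕ) (h : ℝ)
    (γ : ℕ → E) : Prop :=
  ∀ j, γ j = coeffs τ ω (fun x => G (path t₀ y₀ s γ h x)) j

lemma norm_sum_smul_le (a : Fin k → ℝ) (v : Fin k → E) {K : ℝ} (hv : ∀ l, ‖v l‖ ≤ K) :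
    ‖∑ l, a l • v l‖ ≤ (∑ l, |a l|) * K := by
  rw [Finset.sum_mul]
  refine (norm_sum_le _ _).trans (Finset.sum_le_sum fun l _ => ?_)
  rw [norm_smul, Real.norm_eq_abs]
  exact mul_le_mul_of_nonneg_left (hv l) (abs_nonneg _)

lemma sum_smul_sum_pow {τ ω : Fin k → ℝ} {N : ℕ} (hω : QuadratureOrderAtLeast τ ω N) {q : ℝ[X]}
    {n : ℕ} (hq : q.natDegree + n ≤ N) (a : ℝ) (v : ℕ → E) :
    ∑ l, (ω l * q.eval (τ l)) • ∑ i ∈ Finset.range n, (τ l - a) ^ i • v i =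
      ∑ i ∈ Finset.range n, polyIntegral (q * (X - C a) ^ i) • v i := by
  simp_rw [Finset.smul_sum]
  rw [Finset.sum_comm]
  refine Finset.sum_congr rfl fun i hi => ?_
  have hd : (q * (X - C a) ^ i).natDegree < N := by
    refine lt_of_le_of_lt natDegree_mul_le ?_
    rw [natDegree_pow, natDegree_X_sub_C]
    have := Finset.mem_range.1 hi
    omega
  rw [← hω.sum_eval hd, Finset.sum_smul]
  refine Finset.sum_congr rfl fun l _ => ?_
  rw [smul_smul]
  congr 1
  simp [mul_assoc]

lemma integral_smul_sum_pow [CompleteSpace E] (q : ℝ[X]) (n : ℕ) (a : ℝ) (v : ℕ → E) :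
    ∫ x in (0 : ℝ)..1, q.eval x • ∑ i ∈ Finset.range n, (x - a) ^ i • v i =
      ∑ i ∈ Finset.range n, polyIntegral (q * (X - C a) ^ i) • v i := by
  simp_rw [Finset.smul_sum]
  rw [intervalIntegral.integral_finsetSum]
  · refine Finset.sum_congr rfl fun i _ => ?_
    simp_rw [smul_smul]
    rw [intervalIntegral.integral_smul_const, polyIntegral_apply]
    simp
  · intro i _
    have := q.continuous
    exact Continuous.intervalIntegrable (by fun_prop) _ _

lemma coeffs_sub (τ ω : Fin k → ℝ) (φ ψ : ℝ → E) (j : ℕ) :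
    coeffs τ ω (fun x => φ x - ψ x) j = coeffs τ ω φ j - coeffs τ ω ψ j := by
  simp [coeffs, smul_sub, Finset.sum_sub_distrib]

lemma legendreSum_sub (s : ℕ) (γ δ : ℕ → E) (x : ℝ) :
    legendreSum s (fun j => γ j - δ j) x = legendreSum s γ x - legendreSum s δ x := by
  simp [legendreSum, smul_sub, Finset.sum_sub_distrib]

section Estimates

variable {τ ω : Fin k → ℝ} {s : ℕ} {R : ℝ}

lemma norm_coeffs_le (hτ : ∀ l, τ l ∈ Icc (-R) R) {φ : ℝ → E} {K : ℝ}
    (hK : ∀ x ∈ Icc (-R) R, ‖φ x‖ ≤ K) (j : ℕ) :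
    ‖coeffs τ ω φ j‖ ≤ (∑ l, |ω l * (P j).eval (τ l)|) * K :=
  norm_sum_smul_le _ _ fun l => hK _ (hτ l)

lemma coeffs_sum_pow (hω : QuadratureOrderAtLeast τ ω (2 * s)) {j n : ℕ} (hjn : j + n ≤ 2 * s)
    (a : ℝ) (v : ℕ → E) :
    coeffs τ ω (fun x => ∑ i ∈ Finset.range n, (x - a) ^ i • v i) j =
      ∑ i ∈ Finset.range n, polyIntegral (P j * (X - C a) ^ i) • v i :=
  sum_smul_sum_pow hω (by rwa [natDegree_P]) a v

/-- On polynomials of degree below `n ≤ j` the quadrature is exact, because `j + n ≤ 2 * s`, and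
orthogonality to `P j` makes the coefficient vanish. -/
lemma norm_coeffs_le_of_le (hω : QuadratureOrderAtLeast τ ω (2 * s)) (hR : 0 < R)
    (hτ : ∀ l, τ l ∈ Icc (-R) R) {j n : ℕ} (hnj : n ≤ j) (hj : j < s) {φ : ℝ → E}
    (hφ : ContDiff ℝ n φ) {K : ℝ} (hK : ∀ x ∈ Icc (-R) R, ‖iteratedDeriv n φ x‖ ≤ K) :
    ‖coeffs τ ω φ j‖ ≤ (∑ l, |ω l * (P j).eval (τ l)|) * (R - -R) ^ n * K := by
  refine norm_le_of_vanishing (by linarith) (fun φ => coeffs τ ω φ j)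
    (fun φ ψ _ _ => coeffs_sub τ ω φ ψ j) (fun φ _ K hK => norm_coeffs_le hτ hK j) (fun v => ?_)
    hφ hK
  rw [coeffs_sum_pow hω (by omega)]
  refine Finset.sum_eq_zero fun i hi => ?_
  rw [polyIntegral_P_mul_of_degree_lt, zero_smul]
  rw [degree_pow, degree_X_sub_C]
  have := Finset.mem_range.1 hi
  simpa using (by exact_mod_cast (by omega : i < j) : (i : WithBot ℕ) < j)

/-- By exactness the discrete Legendre projection reproduces polynomials of degree below `s`. -/
lemma exists_norm_legendreSum_coeffs_sub_le (hω : QuadratureOrderAtLeast τ ω (2 * s)) (hR : 0 < R)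
    (hτ : ∀ l, τ l ∈ Icc (-R) R) :
    ∃ M : ℝ, 0 ≤ M ∧ ∀ (φ : ℝ → E) (K : ℝ), ContDiff ℝ s φ →
      (∀ x ∈ Icc (-R) R, ‖iteratedDeriv s φ x‖ ≤ K) → ∀ x ∈ Icc (-R) R,
        ‖legendreSum s (coeffs τ ω φ) x - φ x‖ ≤ M * K := by
  have hp (j : ℕ) := exists_abs_eval_le (P j) R
  choose p hp0 hp using hp
  set M : ℝ := ∑ j ∈ Finset.range s, p j * ∑ l, |ω l * (P j).eval (τ l)| + 1
  have hM : 0 ≤ M := add_nonneg (Finset.sum_nonneg fun j _ => mul_nonneg (hp0 j)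
    (Finset.sum_nonneg fun l _ => abs_nonneg _)) zero_le_one
  refine ⟨M * (R - -R) ^ s, mul_nonneg hM (pow_nonneg (by linarith) _), fun φ K hφ hK x hx => ?_⟩
  refine norm_le_of_vanishing (by linarith)
    (fun φ : ℝ → E => legendreSum s (coeffs τ ω φ) x - φ x) (fun φ ψ _ _ => ?_)
    (fun φ _ K hK => ?_) (fun v => ?_) hφ hK
  · rw [show coeffs τ ω (fun x => φ x - ψ x) = fun j => coeffs τ ω φ j - coeffs τ ω ψ j from
      funext fun j => coeffs_sub τ ω φ ψ j, legendreSum_sub]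
    exact sub_sub_sub_comm _ _ _ _
  · refine (norm_sub_le _ _).trans ?_
    rw [add_mul, one_mul, Finset.sum_mul]
    refine add_le_add ((norm_sum_le _ _).trans (Finset.sum_le_sum fun j _ => ?_)) (hK x hx)
    rw [norm_smul, mul_assoc, Real.norm_eq_abs]
    exact mul_le_mul (hp j x hx) (norm_coeffs_le hτ hK j) (norm_nonneg _) (hp0 j)
  · rw [sub_eq_zero, legendreSum]
    have h1 : ∀ j ∈ Finset.range s,
        (P j).eval x • coeffs τ ω (fun x => ∑ i ∈ Finset.range s, (x - -R) ^ i • v i) j =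
          ∑ i ∈ Finset.range s,
            ((C (polyIntegral (P j * (X - C (-R)) ^ i)) * P j).eval x) • v i := by
      intro j hj
      have := Finset.mem_range.1 hj
      rw [coeffs_sum_pow hω (by omega), Finset.smul_sum]
      refine Finset.sum_congr rfl fun i _ => ?_
      rw [smul_smul, eval_mul, eval_C, mul_comm]
    rw [Finset.sum_congr rfl h1, Finset.sum_comm]
    refine Finset.sum_congr rfl fun i hi => ?_
    rw [← Finset.sum_smul, ← eval_finsetSum, sum_polyIntegral_P_mul]
    · simp
    · rw [degree_pow, degree_X_sub_C]
      simpa using (by exact_mod_cast Finset.mem_range.1 hi : (i : WithBot ℕ) < s)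

variable [CompleteSpace E]

/-- As `X ^ j` has degree below `s`, its Legendre expansion resums at each node: the moment of the
discrete projection is the quadrature of `x ^ j • φ x`. -/
lemma integral_pow_smul_legendreSum_coeffs {j : ℕ} (hj : j < s) (φ : ℝ → E) :
    ∫ x in (0 : ℝ)..1, x ^ j • legendreSum s (coeffs τ ω φ) x =
      ∑ l, (ω l * (X ^ j : ℝ[X]).eval (τ l)) • φ (τ l) := by
  have h1 : ∫ x in (0 : ℝ)..1, x ^ j • legendreSum s (coeffs τ ω φ) x =
      ∑ i ∈ Finset.range s, polyIntegral (P i * X ^ j) • coeffs τ ω φ i := by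
    simp_rw [legendreSum, Finset.smul_sum]
    rw [intervalIntegral.integral_finsetSum]
    · refine Finset.sum_congr rfl fun i _ => ?_
      simp_rw [smul_smul]
      rw [intervalIntegral.integral_smul_const, polyIntegral_apply]
      simp [mul_comm]
    · intro i _
      have := (P i).continuous
      exact Continuous.intervalIntegrable (by fun_prop) _ _
  rw [h1]
  simp_rw [coeffs, Finset.smul_sum]
  rw [Finset.sum_comm]
  refine Finset.sum_congr rfl fun l _ => ?_
  simp_rw [smul_smul]
  rw [← Finset.sum_smul]
  congr 1
  have hd : (X ^ j : ℝ[X]).degree < s := by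
    rw [degree_X_pow]
    exact_mod_cast hj
  conv_rhs => rw [← sum_polyIntegral_P_mul hd, eval_finsetSum, Finset.mul_sum]
  refine Finset.sum_congr rfl fun i _ => ?_
  rw [eval_mul, eval_C]
  ring

/-- The moment of the defect is the quadrature error for `x ^ j • φ x`, which is zero for `φ` of
degree below `2 * s - j`. The gain over the pointwise order `s` is the source of superconvergence.
-/
lemma exists_norm_integral_pow_smul_defect_le (hω : QuadratureOrderAtLeast τ ω (2 * s))
    (hR : 1 ≤ R) (hτ : ∀ l, τ l ∈ Icc (-R) R) {j : ℕ} (hj : j < s) :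
    ∃ M : ℝ, 0 ≤ M ∧ ∀ (φ : ℝ → E) (K : ℝ), ContDiff ℝ (2 * s - j : ℕ) φ →
      (∀ x ∈ Icc (-R) R, ‖iteratedDeriv (2 * s - j) φ x‖ ≤ K) →
        ‖∫ x in (0 : ℝ)..1, x ^ j • (legendreSum s (coeffs τ ω φ) x - φ x)‖ ≤ M * K := by
  set M : ℝ := ∑ l, |ω l * (X ^ j : ℝ[X]).eval (τ l)| + 1
  have hM : 0 ≤ M := add_nonneg (Finset.sum_nonneg fun l _ => abs_nonneg _) zero_le_one
  refine ⟨M * (R - -R) ^ (2 * s - j), mul_nonneg hM (pow_nonneg (by linarith) _),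
    fun φ K hφ hK => ?_⟩
  have hint (φ : ℝ → E) (hφ : Continuous φ) :
      IntervalIntegrable (fun x : ℝ => x ^ j • φ x) MeasureTheory.volume 0 1 :=
    Continuous.intervalIntegrable (by fun_prop) _ _
  have he : ∫ x in (0 : ℝ)..1, x ^ j • (legendreSum s (coeffs τ ω φ) x - φ x) =
      (∑ l, (ω l * (X ^ j : ℝ[X]).eval (τ l)) • φ (τ l)) - ∫ x in (0 : ℝ)..1, x ^ j • φ x := by
    simp_rw [smul_sub]
    rw [intervalIntegral.integral_sub (hint _ (continuous_legendreSum _ _)) (hint _ hφ.continuous),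
      integral_pow_smul_legendreSum_coeffs hj]
  rw [he]
  refine norm_le_of_vanishing (by linarith)
    (fun φ : ℝ → E => (∑ l, (ω l * (X ^ j : ℝ[X]).eval (τ l)) • φ (τ l)) -
      ∫ x in (0 : ℝ)..1, x ^ j • φ x) (fun φ ψ hφ hψ => ?_)
    (fun φ _ K hK => ?_) (fun v => ?_) hφ hK
  · simp_rw [smul_sub]
    rw [intervalIntegral.integral_sub (hint _ hφ) (hint _ hψ), Finset.sum_sub_distrib]
    abel
  · refine (norm_sub_le _ _).trans ?_
    rw [add_mul, one_mul]
    refine add_le_add (norm_sum_smul_le _ _ fun l => hK _ (hτ l)) ?_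
    have := intervalIntegral.norm_integral_le_of_norm_le_const (a := 0) (b := 1) (C := K)
      (f := fun x : ℝ => x ^ j • φ x) (fun x hx => ?_)
    · simpa using this
    · rw [uIoc_of_le zero_le_one] at hx
      have hφx := hK x ⟨by linarith [hx.1], by linarith [hx.2]⟩
      rw [norm_smul, norm_pow, Real.norm_of_nonneg hx.1.le]
      exact (mul_le_of_le_one_left (norm_nonneg _) (pow_le_one₀ hx.1.le hx.2)).trans hφx
  · have h1 := integral_smul_sum_pow (X ^ j : ℝ[X]) (2 * s - j) (-R) v
    simp only [eval_pow, eval_X] at h1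
    rw [sum_smul_sum_pow hω (by rw [natDegree_X_pow]; omega), h1, sub_self]

end Estimates

/-! ### Size of the coefficients and of the defect. -/

section Collocation

variable {τ ω : Fin k → ℝ} {s : ℕ} {R : ℝ} {G : ℝ × E → E} {C : ℝ}

/-- Bootstrap on `m`. Boundedness of `G` starts it. Bounds up to `h ^ m` make the derivative of
order `m + 1` of `G` along the curve `O(h ^ (m + 1))`, and `norm_coeffs_le_of_le` returns this for
`γ j` with `m + 1 ≤ j`. -/
lemma exists_norm_collocation_le_pow (hω : QuadratureOrderAtLeast τ ω (2 * s)) (hR : 0 < R)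
    (hτ : ∀ l, τ l ∈ Icc (-R) R) (hG : ContDiff ℝ (2 * s : ℕ) G)
    (hC : ∀ i ≤ 2 * s, ∀ p, ‖iteratedFDeriv ℝ i G p‖ ≤ C) (m : ℕ) :
    ∃ K : ℝ, 0 ≤ K ∧ ∀ (t₀ : ℝ) (y₀ : E), ∀ h ∈ Ioc (0 : ℝ) 1, ∀ γ : ℕ → E,
      IsCollocation τ ω G t₀ y₀ s h γ → ∀ n ≤ m, ∀ j, n ≤ j → j < s → ‖γ j‖ ≤ K * h ^ n := by
  set A : ℝ := ∑ j ∈ Finset.range s, ∑ l, |ω l * (P j).eval (τ l)|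
  have hA (j : ℕ) (hj : j < s) : ∑ l, |ω l * (P j).eval (τ l)| ≤ A :=
    Finset.single_le_sum (f := fun j => ∑ l, |ω l * (P j).eval (τ l)|)
      (fun j _ => Finset.sum_nonneg fun l _ => abs_nonneg _) (Finset.mem_range.2 hj)
  have hA0 : 0 ≤ A := Finset.sum_nonneg fun j _ => Finset.sum_nonneg fun l _ => abs_nonneg _
  have hC0 : 0 ≤ C := (norm_nonneg _).trans (hC 0 (Nat.zero_le _) 0)
  induction m with
  | zero =>
    refine ⟨A * C, mul_nonneg hA0 hC0, fun t₀ y₀ h hh γ hγ n hn j _ hj => ?_⟩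
    obtain rfl : n = 0 := by omega
    rw [pow_zero, mul_one, hγ j]
    refine (norm_coeffs_le hτ (K := C) (fun x _ => ?_) j).trans
      (mul_le_mul_of_nonneg_right (hA j hj) hC0)
    simpa using hC 0 (Nat.zero_le _) (path t₀ y₀ s γ h x)
  | succ m ih =>
    obtain ⟨K, hK0, hK⟩ := ih
    obtain ⟨K', hK'0, hK'⟩ :=
      exists_norm_iteratedDeriv_comp_path_le (E := E) (F := E) s m (2 * s) R K C hK0
    refine ⟨max K (A * (R - -R) ^ (m + 1) * K'), le_max_of_le_left hK0,
      fun t₀ y₀ h hh γ hγ n hn j hnj hj => ?_⟩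
    have hhn : 0 ≤ h ^ n := pow_nonneg hh.1.le n
    rcases Nat.le_succ_iff.1 hn with hn | rfl
    · exact (hK t₀ y₀ h hh γ hγ n hn j hnj hj).trans
        (mul_le_mul_of_nonneg_right (le_max_left _ _) hhn)
    · have hms : m + 1 ≤ 2 * s := by omega
      have hφ : ContDiff ℝ (m + 1 : ℕ) fun x => G (path t₀ y₀ s γ h x) :=
        (hG.of_le (by exact_mod_cast hms)).comp (contDiff_path t₀ y₀ s γ h)
      have h1 := norm_coeffs_le_of_le hω hR hτ hnj hj hφ (fun x hx =>
        hK' G hG hC t₀ y₀ h hh γ (hK t₀ y₀ h hh γ hγ) x hx (m + 1) le_rfl hms)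
      rw [← hγ j] at h1
      refine h1.trans (le_trans ?_ (mul_le_mul_of_nonneg_right (le_max_right _ _) hhn))
      rw [← mul_assoc]
      have := hA j hj
      have : 0 ≤ (R - -R) ^ (m + 1) := pow_nonneg (by linarith) _
      gcongr

/-- All derivatives of a smooth function along the collocation polynomial have the natural size. -/
lemma exists_norm_iteratedDeriv_collocation_le {F : Type*} [NormedAddCommGroup F] [NormedSpace ℝ F]
    (hω : QuadratureOrderAtLeast τ ω (2 * s)) (hR : 0 < R)
    (hτ : ∀ l, τ l ∈ Icc (-R) R) (hG : ContDiff ℝ (2 * s : ℕ) G)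
    (hC : ∀ i ≤ 2 * s, ∀ p, ‖iteratedFDeriv ℝ i G p‖ ≤ C) {H : ℝ × E → F} {N : ℕ} {C' : ℝ}
    (hH : ContDiff ℝ N H) (hC' : ∀ i ≤ N, ∀ p, ‖iteratedFDeriv ℝ i H p‖ ≤ C') :
    ∃ K : ℝ, 0 ≤ K ∧ ∀ (t₀ : ℝ) (y₀ : E), ∀ h ∈ Ioc (0 : ℝ) 1, ∀ γ : ℕ → E,
      IsCollocation τ ω G t₀ y₀ s h γ → ∀ x ∈ Icc (-R) R, ∀ i ≤ N,
        ‖iteratedDeriv i (fun x => H (path t₀ y₀ s γ h x)) x‖ ≤ K * h ^ i := by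
  obtain ⟨K, hK0, hK⟩ := exists_norm_collocation_le_pow hω hR hτ hG hC N
  obtain ⟨K', hK'0, hK'⟩ := exists_norm_iteratedDeriv_comp_path_le (E := E) (F := F) s N N R K C' hK0
  exact ⟨K', hK'0, fun t₀ y₀ h hh γ hγ x hx i hi =>
    hK' H hH hC' t₀ y₀ h hh γ (hK t₀ y₀ h hh γ hγ) x hx i (by omega) hi⟩

lemma exists_norm_defect_le (hω : QuadratureOrderAtLeast τ ω (2 * s)) (hR : 0 < R)
    (hτ : ∀ l, τ l ∈ Icc (-R) R) (hG : ContDiff ℝ (2 * s : ℕ) G)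
    (hC : ∀ i ≤ 2 * s, ∀ p, ‖iteratedFDeriv ℝ i G p‖ ≤ C) :
    ∃ K : ℝ, 0 ≤ K ∧ ∀ (t₀ : ℝ) (y₀ : E), ∀ h ∈ Ioc (0 : ℝ) 1, ∀ γ : ℕ → E,
      IsCollocation τ ω G t₀ y₀ s h γ → ∀ x ∈ Icc (-R) R,
        ‖legendreSum s γ x - G (path t₀ y₀ s γ h x)‖ ≤ K * h ^ s := by
  obtain ⟨K, hK0, hK⟩ := exists_norm_iteratedDeriv_collocation_le hω hR hτ hG hC hG hC
  obtain ⟨M, hM0, hM⟩ := exists_norm_legendreSum_coeffs_sub_le (E := E) hω hR hτ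
  refine ⟨M * K, mul_nonneg hM0 hK0, fun t₀ y₀ h hh γ hγ x hx => ?_⟩
  have hφ : ContDiff ℝ s fun x => G (path t₀ y₀ s γ h x) :=
    (hG.of_le (by exact_mod_cast (by omega : s ≤ 2 * s))).comp (contDiff_path t₀ y₀ s γ h)
  have h1 := hM _ _ hφ (fun x hx => hK t₀ y₀ h hh γ hγ x hx s (by omega)) x hx
  -- `IsCollocation` constrains every index, also `j ≥ s`, so `γ` and `coeffs` are equal as
  -- functions.
  rw [← funext hγ] at h1
  rwa [mul_assoc]

lemma exists_norm_integral_pow_smul_collocation_defect_le [CompleteSpace E]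
    (hω : QuadratureOrderAtLeast τ ω (2 * s)) (hR : 1 ≤ R)
    (hτ : ∀ l, τ l ∈ Icc (-R) R) (hG : ContDiff ℝ (2 * s : ℕ) G)
    (hC : ∀ i ≤ 2 * s, ∀ p, ‖iteratedFDeriv ℝ i G p‖ ≤ C) {j : ℕ} (hj : j < s) :
    ∃ K : ℝ, 0 ≤ K ∧ ∀ (t₀ : ℝ) (y₀ : E), ∀ h ∈ Ioc (0 : ℝ) 1, ∀ γ : ℕ → E,
      IsCollocation τ ω G t₀ y₀ s h γ →
        ‖∫ x in (0 : ℝ)..1, x ^ j • (legendreSum s γ x - G (path t₀ y₀ s γ h x))‖ ≤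
          K * h ^ (2 * s - j) := by
  obtain ⟨K, hK0, hK⟩ :=
    exists_norm_iteratedDeriv_collocation_le hω (by linarith) hτ hG hC hG hC
  obtain ⟨M, hM0, hM⟩ := exists_norm_integral_pow_smul_defect_le (E := E) hω hR hτ hj
  refine ⟨M * K, mul_nonneg hM0 hK0, fun t₀ y₀ h hh γ hγ => ?_⟩
  have hφ : ContDiff ℝ (2 * s - j : ℕ) fun x => G (path t₀ y₀ s γ h x) :=
    (hG.of_le (by exact_mod_cast (by omega : 2 * s - j ≤ 2 * s))).comp (contDiff_path t₀ y₀ s γ h)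
  have h1 := hM _ _ hφ (fun x hx => hK t₀ y₀ h hh γ hγ x hx (2 * s - j) (by omega))
  rw [← funext hγ] at h1
  rwa [mul_assoc]

end Collocation

end HBVM

/-! ### Approximate polynomial solution of the adjoint equation. -/

section Adjoint

variable {A : Type*} [NormedRing A] [NormedAlgebra ℝ A]

/-- The power series recursion of `W' = -h W β` for `β = ∑ x ^ j • B j`. -/
lemma exists_sum_recursion (h : ℝ) (B : ℕ → A) :
    ∃ W : ℕ → A, W 0 = 1 ∧
      ∀ n, W (n + 1) = -((h / (n + 1)) • ∑ i ∈ Finset.range (n + 1), W i * B (n - i)) := by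
  let W : ℕ → A := Nat.strongRec fun n ih => match n, ih with
    | 0, _ => 1
    | n + 1, ih => -((h / (n + 1)) • ∑ i : Fin (n + 1), ih i i.2 * B (n - i))
  refine ⟨W, ?_, fun n => ?_⟩
  · simp only [W]
    rw [Nat.strongRec_eq]
  · rw [Finset.sum_range fun i => W i * B (n - i)]
    simp only [W]
    rw [Nat.strongRec_eq]

/-- The sum has `n + 1` terms of size `D ^ (n + 1) * h ^ n`, and the divisor `n + 1` absorbs their
number. Asking for `‖1‖ ≤ 1` rather than equality admits operators on the zero space. -/
lemma norm_sum_recursion_le (h1 : ‖(1 : A)‖ ≤ 1) {p : ℕ} {C D h : ℝ} (hh : 0 ≤ h) (hC : 0 ≤ C)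
    (hCD : C ≤ D) (hD : 1 ≤ D) {B W : ℕ → A} (hB : ∀ j < p, ‖B j‖ ≤ C * h ^ j) (hW0 : W 0 = 1)
    (hW : ∀ n, W (n + 1) = -((h / (n + 1)) • ∑ i ∈ Finset.range (n + 1), W i * B (n - i))) :
    ∀ n ≤ p, ‖W n‖ ≤ (D * h) ^ n := by
  intro n
  induction n using Nat.strong_induction_on with
  | _ n ih =>
    intro hn
    rcases n with _ | n
    · simpa [hW0] using h1
    have hn1 : (0 : ℝ) < n + 1 := by positivity
    have ht : ∀ i ∈ Finset.range (n + 1), ‖W i * B (n - i)‖ ≤ D ^ (n + 1) * h ^ n := by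
      intro i hi
      have hi' := Finset.mem_range.1 hi
      refine (norm_mul_le _ _).trans ?_
      have e1 := ih i hi' (by omega)
      have e2 := hB (n - i) (by omega)
      calc ‖W i‖ * ‖B (n - i)‖ ≤ (D * h) ^ i * (C * h ^ (n - i)) := by gcongr
        _ = D ^ i * C * h ^ (i + (n - i)) := by rw [mul_pow, pow_add]; ring
        _ = D ^ i * C * h ^ n := by rw [Nat.add_sub_cancel' (by omega)]
        _ ≤ D ^ n * D * h ^ n := by gcongr; omega
        _ = D ^ (n + 1) * h ^ n := by rw [pow_succ]
    rw [hW, norm_neg, norm_smul, Real.norm_of_nonneg (div_nonneg hh hn1.le)]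
    have hs := (norm_sum_le _ _).trans (Finset.sum_le_sum ht)
    rw [Finset.sum_const, Finset.card_range, nsmul_eq_mul] at hs
    push_cast at hs
    calc h / (n + 1) * ‖∑ i ∈ Finset.range (n + 1), W i * B (n - i)‖
        ≤ h / (n + 1) * ((n + 1) * (D ^ (n + 1) * h ^ n)) := by gcongr
      _ = (D * h) ^ (n + 1) := by field_simp; ring

/-- Applied to the product of the two truncated series: the terms of total degree below `p` cancel
against `W'`, and the others are `O(h ^ p)`. -/
lemma sum_range_antidiagonal_add {M : Type*} [AddCommMonoid M] (p : ℕ) (f : ℕ → ℕ → M) :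
    ∑ i ∈ Finset.range (p + 1), ∑ j ∈ Finset.range p, f i j =
      (∑ n ∈ Finset.range p, ∑ i ∈ Finset.range (n + 1), f i (n - i)) +
        ∑ i ∈ Finset.range (p + 1), ∑ j ∈ Finset.Ico (p - i) p, f i j := by
  have h1 : ∑ n ∈ Finset.range p, ∑ i ∈ Finset.range (n + 1), f i (n - i) =
      ∑ i ∈ Finset.range (p + 1), ∑ j ∈ Finset.range (p - i), f i j := by
    rw [Finset.sum_comm' (t' := Finset.range (p + 1)) (s' := fun i => Finset.Ico i p)
      (by intro x y; simp only [Finset.mem_range, Finset.mem_Ico]; omega)]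
    refine Finset.sum_congr rfl fun i _ => ?_
    rw [Finset.sum_Ico_eq_sum_range]
    exact Finset.sum_congr rfl fun j _ => by rw [Nat.add_sub_cancel_left]
  rw [h1, ← Finset.sum_add_distrib]
  refine Finset.sum_congr rfl fun i _ => ?_
  rw [Finset.sum_range_add_sum_Ico _ (by omega)]

/-- An approximate solution, polynomial of degree `p`, of the adjoint equation `W' = -h W β`. -/
lemma exists_approx_adjoint (h1 : ‖(1 : A)‖ ≤ 1) (p : ℕ) {C : ℝ} (hC : 0 ≤ C) :
    ∃ K : ℝ, 0 ≤ K ∧ ∀ h ∈ Ioc (0 : ℝ) 1, ∀ (B : ℕ → A) (β : ℝ → A),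
      (∀ j < p, ‖B j‖ ≤ C * h ^ j) →
      (∀ x ∈ Icc (0 : ℝ) 1, ‖β x - ∑ j ∈ Finset.range p, x ^ j • B j‖ ≤ C * h ^ p) →
      ∃ W : ℕ → A, W 0 = 1 ∧ (∀ i ≤ p, ‖W i‖ ≤ K * h ^ i) ∧
        ∀ x ∈ Icc (0 : ℝ) 1, ‖(∑ i ∈ Finset.range p, x ^ i • (((i : ℝ) + 1) • W (i + 1))) +
          h • ((∑ i ∈ Finset.range (p + 1), x ^ i • W i) * β x)‖ ≤ K * h ^ (p + 1) := by
  set D : ℝ := max C 1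
  have hCD : C ≤ D := le_max_left _ _
  have hD1 : 1 ≤ D := le_max_right _ _
  -- The first summand bounds the `W i`; the others bound the products of total degree at least `p`
  -- and the Taylor remainder of `β`.
  refine ⟨D ^ p + ((p + 1) * (p * (D ^ p * C)) + (p + 1) * D ^ p * C), by positivity,
    fun h hh B β hB hβ => ?_⟩
  obtain ⟨W, hW0, hW⟩ := exists_sum_recursion h B
  have hWn := norm_sum_recursion_le h1 hh.1.le hC hCD hD1 hB hW0 hW
  have hh0 := hh.1.le
  have hWp : ∀ i ≤ p, ‖W i‖ ≤ D ^ p * h ^ i := fun i hi =>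
    (hWn i hi).trans (by rw [mul_pow]; gcongr)
  refine ⟨W, hW0, fun i hi => (hWp i hi).trans ?_, fun x hx => ?_⟩
  · gcongr
    exact le_add_of_nonneg_right (by positivity)
  have hxp (i : ℕ) : ‖x ^ i‖ ≤ 1 := by
    rw [norm_pow, Real.norm_of_nonneg hx.1]
    exact pow_le_one₀ hx.1 hx.2
  have hprod : (∑ i ∈ Finset.range (p + 1), x ^ i • W i) * ∑ j ∈ Finset.range p, x ^ j • B j =
      (∑ n ∈ Finset.range p, x ^ n • ∑ i ∈ Finset.range (n + 1), W i * B (n - i)) +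
        ∑ i ∈ Finset.range (p + 1), ∑ j ∈ Finset.Ico (p - i) p, x ^ (i + j) • (W i * B j) := by
    rw [Finset.sum_mul_sum]
    simp_rw [smul_mul_smul_comm, ← pow_add]
    rw [sum_range_antidiagonal_add]
    congr 1
    refine Finset.sum_congr rfl fun n _ => ?_
    rw [Finset.smul_sum]
    refine Finset.sum_congr rfl fun i hi => ?_
    rw [Nat.add_sub_cancel' (by have := Finset.mem_range.1 hi; omega)]
  have hd : ∑ i ∈ Finset.range p, x ^ i • (((i : ℝ) + 1) • W (i + 1)) =
      -(h • ∑ n ∈ Finset.range p, x ^ n • ∑ i ∈ Finset.range (n + 1), W i * B (n - i)) := by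
    rw [Finset.smul_sum, ← Finset.sum_neg_distrib]
    refine Finset.sum_congr rfl fun n _ => ?_
    have hn1 : (n : ℝ) + 1 ≠ 0 := by positivity
    rw [hW, smul_neg, smul_neg, smul_smul, smul_smul, smul_smul]
    congr 2
    field_simp
  have hsplit : (∑ i ∈ Finset.range p, x ^ i • (((i : ℝ) + 1) • W (i + 1))) +
      h • ((∑ i ∈ Finset.range (p + 1), x ^ i • W i) * β x) =
      h • ((∑ i ∈ Finset.range (p + 1), ∑ j ∈ Finset.Ico (p - i) p, x ^ (i + j) • (W i * B j)) +
        (∑ i ∈ Finset.range (p + 1), x ^ i • W i) *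
          (β x - ∑ j ∈ Finset.range p, x ^ j • B j)) := by
    rw [mul_sub, hprod, hd]
    module
  rw [hsplit, norm_smul, Real.norm_of_nonneg hh0]
  have b1 : ‖∑ i ∈ Finset.range (p + 1), ∑ j ∈ Finset.Ico (p - i) p, x ^ (i + j) • (W i * B j)‖ ≤
      (p + 1) * (p * (D ^ p * C)) * h ^ p := by
    have ht : ∀ i ∈ Finset.range (p + 1),
        ‖∑ j ∈ Finset.Ico (p - i) p, x ^ (i + j) • (W i * B j)‖ ≤ p * (D ^ p * C) * h ^ p := by
      intro i hi
      have hi' := Finset.mem_range.1 hi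
      have ht : ∀ j ∈ Finset.Ico (p - i) p, ‖x ^ (i + j) • (W i * B j)‖ ≤ D ^ p * C * h ^ p := by
        intro j hj
        have hj' := Finset.mem_Ico.1 hj
        rw [norm_smul]
        refine (mul_le_of_le_one_left (norm_nonneg _) (hxp _)).trans ((norm_mul_le _ _).trans ?_)
        have e1 := hWp i (by omega)
        have e2 := hB j hj'.2
        calc ‖W i‖ * ‖B j‖ ≤ (D ^ p * h ^ i) * (C * h ^ j) := by gcongr
          _ = D ^ p * C * h ^ (i + j) := by rw [pow_add]; ring
          _ ≤ D ^ p * C * h ^ p := by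
            gcongr ?_ * ?_
            exact pow_le_pow_of_le_one hh0 hh.2 (by omega)
      have hs := (norm_sum_le _ _).trans (Finset.sum_le_sum ht)
      rw [Finset.sum_const, Nat.card_Ico, nsmul_eq_mul] at hs
      refine hs.trans ?_
      rw [mul_assoc (p : ℝ)]
      gcongr
      omega
    have hs := (norm_sum_le _ _).trans (Finset.sum_le_sum ht)
    rw [Finset.sum_const, Finset.card_range, nsmul_eq_mul] at hs
    push_cast at hs
    linarith
  have b2 : ‖∑ i ∈ Finset.range (p + 1), x ^ i • W i‖ ≤ (p + 1) * D ^ p := by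
    have ht : ∀ i ∈ Finset.range (p + 1), ‖x ^ i • W i‖ ≤ D ^ p := by
      intro i hi
      have hi' := Finset.mem_range.1 hi
      rw [norm_smul]
      refine (mul_le_of_le_one_left (norm_nonneg _) (hxp _)).trans ((hWp i (by omega)).trans ?_)
      exact mul_le_of_le_one_right (by positivity) (pow_le_one₀ hh0 hh.2)
    have hs := (norm_sum_le _ _).trans (Finset.sum_le_sum ht)
    rw [Finset.sum_const, Finset.card_range, nsmul_eq_mul] at hs
    push_cast at hs
    exact hs
  have b3 := hβ x hx
  have b4 : ‖(∑ i ∈ Finset.range (p + 1), x ^ i • W i) *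
      (β x - ∑ j ∈ Finset.range p, x ^ j • B j)‖ ≤ (p + 1) * D ^ p * (C * h ^ p) :=
    (norm_mul_le _ _).trans (by gcongr)
  have b5 : 0 ≤ D ^ p * h ^ (p + 1) := by positivity
  calc _ ≤ h * ((p + 1) * (p * (D ^ p * C)) * h ^ p + (p + 1) * D ^ p * (C * h ^ p)) :=
        mul_le_mul_of_nonneg_left ((norm_add_le _ _).trans (add_le_add b1 b4)) hh0
    _ = ((p + 1) * (p * (D ^ p * C)) + (p + 1) * D ^ p * C) * h ^ (p + 1) := by ring
    _ ≤ _ := by rw [add_mul (D ^ p)]; linarith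

end Adjoint

/-! ### Linearization in the second variable. -/

section Remainder

variable {E F : Type*} [NormedAddCommGroup E] [NormedSpace ℝ E] [NormedAddCommGroup F]
  [NormedSpace ℝ F]

/-- The partial derivative with respect to the second variable. -/
def fderivSnd (G : ℝ × E → F) (p : ℝ × E) : E →L[ℝ] F :=
  (fderiv ℝ G p).comp (ContinuousLinearMap.inr ℝ ℝ E)

lemma contDiff_fderivSnd {G : ℝ × E → F} {n : ℕ} (hG : ContDiff ℝ (n + 1 : ℕ) G) :
    ContDiff ℝ n (fderivSnd G) :=
  ContDiff.clm_comp (hG.fderiv_right (by exact_mod_cast le_rfl)) contDiff_const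

lemma hasCompactSupport_fderivSnd {G : ℝ × E → F} (hG : HasCompactSupport G) :
    HasCompactSupport (fderivSnd G) :=
  (hG.fderiv (𝕜 := ℝ)).comp_left (g := fun f : ℝ × E →L[ℝ] F =>
    f.comp (ContinuousLinearMap.inr ℝ ℝ E)) (by simp)

/-- On the segment from `w` to `z` the derivative differs from that at `z` by at most `L * ‖z - w‖`;
the mean value inequality supplies the second factor. -/
lemma norm_sub_sub_fderivSnd_le {G : ℝ × E → F} (hG : Differentiable ℝ G) {L : NNReal}
    (hL : LipschitzWith L (fderivSnd G)) (t : ℝ) (z w : E) :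
    ‖G (t, z) - G (t, w) - fderivSnd G (t, z) (z - w)‖ ≤ L * ‖z - w‖ ^ 2 := by
  have hd (v : E) : HasFDerivAt (fun v => G (t, v)) (fderivSnd G (t, v)) v :=
    (hG (t, v)).hasFDerivAt.comp v (hasFDerivAt_prodMk_right t v)
  have h := Convex.norm_image_sub_le_of_norm_hasFDerivWithin_le' (f := fun v => G (t, v))
    (f' := fun v => fderivSnd G (t, v)) (φ := fderivSnd G (t, z)) (C := L * ‖z - w‖)
    (s := segment ℝ w z) (fun v _ => (hd v).hasFDerivWithinAt) (fun v hv => ?_)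
    (convex_segment w z) (left_mem_segment ℝ w z) (right_mem_segment ℝ w z)
  · rw [pow_two, ← mul_assoc]
    exact h
  · refine (hL.norm_sub_le _ _).trans ?_
    gcongr
    rw [Prod.mk_sub_mk, sub_self, Prod.norm_mk, norm_zero, max_eq_right (norm_nonneg _),
      norm_sub_rev v z]
    have h2 := norm_sub_le_of_mem_segment (segment_symm ℝ w z ▸ hv)
    rwa [norm_sub_rev v z, norm_sub_rev w z] at h2

end Remainder

/-! ### Error of the collocation polynomial. -/

namespace HBVM

variable {E : Type*} [NormedAddCommGroup E] [NormedSpace ℝ E] {k : ℕ}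

/-- `u x = y (t₀ + x h)` for a solution `y` of `y' = G (t, y)`, `y t₀ = y₀`. -/
def IsScaledSolution (G : ℝ × E → E) (t₀ : ℝ) (y₀ : E) (h : ℝ) (u : ℝ → E) : Prop :=
  u 0 = y₀ ∧ ∀ x ∈ Icc (0 : ℝ) 1, HasDerivWithinAt u (h • G (t₀ + x * h, u x)) (Icc 0 1) x

lemma path_zero_snd (t₀ : ℝ) (y₀ : E) (s : ℕ) (γ : ℕ → E) (h : ℝ) :
    (path t₀ y₀ s γ h 0).2 = y₀ := by
  simp [path, eval_zero_antiderivative]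

variable {G : ℝ × E → E} {t₀ h : ℝ} {y₀ : E} {s : ℕ} {γ : ℕ → E} {u : ℝ → E}

lemma IsScaledSolution.hasDerivWithinAt_error (hu : IsScaledSolution G t₀ y₀ h u) {x : ℝ}
    (hx : x ∈ Icc (0 : ℝ) 1) :
    HasDerivWithinAt (fun x => (path t₀ y₀ s γ h x).2 - u x)
      (h • (legendreSum s γ x - G (t₀ + x * h, u x))) (Icc 0 1) x := by
  rw [smul_sub]
  exact (hasDerivAt_path_snd t₀ y₀ s γ h x).hasDerivWithinAt.sub (hu.2 x hx)

/-- In place of Gronwall: at a maximum point of `‖e‖` the mean value inequality gives max ≤ h (δ + L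
max), and `h * L ≤ 1 / 2` absorbs the last term. -/
lemma IsScaledSolution.norm_error_le (hu : IsScaledSolution G t₀ y₀ h u) {L : NNReal}
    (hL : LipschitzWith L G) (h0 : 0 ≤ h) (hhL : h * L ≤ 1 / 2) {δ : ℝ}
    (hδ : ∀ x ∈ Icc (0 : ℝ) 1, ‖legendreSum s γ x - G (path t₀ y₀ s γ h x)‖ ≤ δ) :
    ∀ x ∈ Icc (0 : ℝ) 1, ‖(path t₀ y₀ s γ h x).2 - u x‖ ≤ 2 * h * δ := by
  set e : ℝ → E := fun x => (path t₀ y₀ s γ h x).2 - u x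
  have hder : ∀ x ∈ Icc (0 : ℝ) 1, HasDerivWithinAt e _ (Icc 0 1) x := fun x hx =>
    hu.hasDerivWithinAt_error (s := s) (γ := γ) hx
  have hcont : ContinuousOn e (Icc 0 1) := fun x hx => (hder x hx).continuousWithinAt
  obtain ⟨z, hz, hmax⟩ := isCompact_Icc.exists_isMaxOn (nonempty_Icc.2 zero_le_one) hcont.norm
  have hmax' : ∀ x ∈ Icc (0 : ℝ) 1, ‖e x‖ ≤ ‖e z‖ := fun x hx => hmax hx
  have hb : ∀ x ∈ Icc (0 : ℝ) 1,
      ‖h • (legendreSum s γ x - G (t₀ + x * h, u x))‖ ≤ h * (δ + L * ‖e z‖) := by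
    intro x hx
    rw [norm_smul, Real.norm_of_nonneg h0]
    refine mul_le_mul_of_nonneg_left ?_ h0
    have h1 := hL.norm_sub_le (path t₀ y₀ s γ h x) (t₀ + x * h, u x)
    have h2 : ‖path t₀ y₀ s γ h x - (t₀ + x * h, u x)‖ = ‖e x‖ := by
      rw [Prod.norm_def]
      simp [e, path]
    rw [h2] at h1
    calc ‖legendreSum s γ x - G (t₀ + x * h, u x)‖
        ≤ ‖legendreSum s γ x - G (path t₀ y₀ s γ h x)‖ +
          ‖G (path t₀ y₀ s γ h x) - G (t₀ + x * h, u x)‖ := norm_sub_le_norm_sub_add_norm_sub _ _ _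
      _ ≤ δ + L * ‖e z‖ := add_le_add (hδ x hx)
          (h1.trans (mul_le_mul_of_nonneg_left (hmax' x hx) L.2))
  have h0mem : (0 : ℝ) ∈ Icc (0 : ℝ) 1 := left_mem_Icc.2 zero_le_one
  have h1 := (convex_Icc (0 : ℝ) 1).norm_image_sub_le_of_norm_hasDerivWithin_le hder hb h0mem hz
  have he0 : e 0 = 0 := by simp only [e, path_zero_snd, hu.1, sub_self]
  have hz1 : ‖z - 0‖ ≤ 1 := by
    rw [sub_zero, Real.norm_of_nonneg hz.1]
    exact hz.2
  have hδ0 : 0 ≤ δ := (norm_nonneg _).trans (hδ 0 h0mem)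
  rw [he0, sub_zero] at h1
  have h2 : ‖e z‖ ≤ h * (δ + L * ‖e z‖) :=
    h1.trans (mul_le_of_le_one_right (mul_nonneg h0
      (add_nonneg hδ0 (mul_nonneg L.2 (norm_nonneg _)))) hz1)
  intro x hx
  refine (hmax' x hx).trans ?_
  nlinarith [norm_nonneg (e z), mul_le_mul_of_nonneg_right hhL (norm_nonneg (e z))]

section Weighted

variable [CompleteSpace E] {p : ℕ}

/-- The weighted error `W 1 (e 1)` for an operator valued polynomial weight `W`. -/
lemma IsScaledSolution.norm_weighted_error_le (hu : IsScaledSolution G t₀ y₀ h u)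
    (hG : Differentiable ℝ G) (hGc : Continuous G) {L : NNReal}
    (hL : LipschitzWith L (fderivSnd G)) (h0 : 0 ≤ h)
    (W : ℕ → E →L[ℝ] E) {ε ρ M μ : ℝ}
    (hε : ∀ x ∈ Icc (0 : ℝ) 1, ‖(path t₀ y₀ s γ h x).2 - u x‖ ≤ ε)
    (hρ : ∀ x ∈ Icc (0 : ℝ) 1, ‖(∑ i ∈ Finset.range p, x ^ i • (((i : ℝ) + 1) • W (i + 1))) +
      h • ((∑ i ∈ Finset.range (p + 1), x ^ i • W i) *
        fderivSnd G (path t₀ y₀ s γ h x))‖ ≤ ρ)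
    (hM : ∀ x ∈ Icc (0 : ℝ) 1, ‖∑ i ∈ Finset.range (p + 1), x ^ i • W i‖ ≤ M)
    (hμ : ‖∑ i ∈ Finset.range (p + 1), W i
      (∫ x in (0 : ℝ)..1, x ^ i • (legendreSum s γ x - G (path t₀ y₀ s γ h x)))‖ ≤ μ) :
    ‖(∑ i ∈ Finset.range (p + 1), W i) ((path t₀ y₀ s γ h 1).2 - u 1)‖ ≤
      ρ * ε + h * (M * (L * ε ^ 2)) + h * μ := by
  set e : ℝ → E := fun x => (path t₀ y₀ s γ h x).2 - u x with he
  set d : ℝ → E := fun x => legendreSum s γ x - G (path t₀ y₀ s γ h x) with hd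
  set w : ℝ → E →L[ℝ] E := fun x => ∑ i ∈ Finset.range (p + 1), x ^ i • W i with hw
  set w' : ℝ → E →L[ℝ] E :=
    fun x => ∑ i ∈ Finset.range p, x ^ i • (((i : ℝ) + 1) • W (i + 1)) with hw'
  have hdc : Continuous d := (continuous_legendreSum s γ).sub
    (hGc.comp (contDiff_path t₀ y₀ s γ h (n := 0)).continuous)
  have hwc : Continuous w := by fun_prop
  have hwder (x : ℝ) : HasDerivAt w (w' x) x := by
    have h1 : HasDerivAt w (∑ i ∈ Finset.range (p + 1), ((i : ℝ) * x ^ (i - 1)) • W i) x :=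
      HasDerivAt.fun_sum fun i _ => (hasDerivAt_pow i x).smul_const (W i)
    rw [Finset.sum_range_succ'] at h1
    simp only [Nat.cast_zero, zero_mul, zero_smul, add_zero, Nat.add_sub_cancel] at h1
    convert h1 using 1
    refine Finset.sum_congr rfl fun i _ => ?_
    rw [smul_smul, mul_comm]
    push_cast
    rfl
  have hwdc : Continuous fun x => w x (d x) := by fun_prop
  set I : ℝ → E := fun x => ∫ z in (0 : ℝ)..x, w z (d z) with hI
  have hIder (x : ℝ) : HasDerivAt I (w x (d x)) x :=
    (hwdc.integral_hasStrictDerivAt 0 x).hasDerivAt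
  have hI1 : I 1 = ∑ i ∈ Finset.range (p + 1), W i (∫ x in (0 : ℝ)..1, x ^ i • d x) := by
    have h1 : ∀ x, w x (d x) = ∑ i ∈ Finset.range (p + 1), W i (x ^ i • d x) := by
      intro x
      simp [hw]
    simp only [hI, h1]
    rw [intervalIntegral.integral_finsetSum]
    · refine Finset.sum_congr rfl fun i _ => ?_
      exact (W i).intervalIntegral_comp_comm (Continuous.intervalIntegrable (by fun_prop) _ _)
    · intro i _
      exact Continuous.intervalIntegrable (by fun_prop) _ _
  -- Subtracting `h • I` removes the defect from the derivative. The defect is small enough only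
  -- after integration, through its moments, and not pointwise.
  set F : ℝ → E := fun x => w x (e x) - h • I x with hF
  have h0mem : (0 : ℝ) ∈ Icc (0 : ℝ) 1 := left_mem_Icc.2 zero_le_one
  have h1mem : (1 : ℝ) ∈ Icc (0 : ℝ) 1 := right_mem_Icc.2 zero_le_one
  have hFder : ∀ x ∈ Icc (0 : ℝ) 1, HasDerivWithinAt F
      ((w' x + h • (w x * fderivSnd G (path t₀ y₀ s γ h x))) (e x) +
        h • w x (G (path t₀ y₀ s γ h x) - G (t₀ + x * h, u x) -
          fderivSnd G (path t₀ y₀ s γ h x) (e x))) (Icc 0 1) x := by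
    intro x hx
    have h1 := ((hwder x).hasDerivWithinAt (s := Icc 0 1)).clm_apply
      (hu.hasDerivWithinAt_error (s := s) (γ := γ) hx)
    have h2 : HasDerivWithinAt F _ (Icc 0 1) x :=
      h1.sub ((hIder x).const_smul h).hasDerivWithinAt
    refine h2.congr_deriv ?_
    simp only [hd, he, add_apply, smul_apply, mul_apply_eq_comp, map_sub,
      map_smul, smul_sub]
    abel
  have hFb : ∀ x ∈ Icc (0 : ℝ) 1,
      ‖(w' x + h • (w x * fderivSnd G (path t₀ y₀ s γ h x))) (e x) +
        h • w x (G (path t₀ y₀ s γ h x) - G (t₀ + x * h, u x) -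
          fderivSnd G (path t₀ y₀ s γ h x) (e x))‖ ≤ ρ * ε + h * (M * (L * ε ^ 2)) := by
    intro x hx
    have hρ0 : 0 ≤ ρ := (norm_nonneg _).trans (hρ x hx)
    have hM0 : 0 ≤ M := (norm_nonneg _).trans (hM x hx)
    refine (norm_add_le _ _).trans (add_le_add ?_ ?_)
    · exact (ContinuousLinearMap.le_opNorm _ _).trans
        (mul_le_mul (hρ x hx) (hε x hx) (norm_nonneg _) hρ0)
    · rw [norm_smul, Real.norm_of_nonneg h0]
      refine mul_le_mul_of_nonneg_left ?_ h0
      refine (ContinuousLinearMap.le_opNorm _ _).trans ?_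
      refine mul_le_mul (hM x hx) ?_ (norm_nonneg _) hM0
      refine (norm_sub_sub_fderivSnd_le hG hL (t₀ + x * h) (path t₀ y₀ s γ h x).2 (u x)).trans ?_
      exact mul_le_mul_of_nonneg_left (pow_le_pow_left₀ (norm_nonneg _) (hε x hx) 2) L.2
  have hmv := (convex_Icc (0 : ℝ) 1).norm_image_sub_le_of_norm_hasDerivWithin_le hFder hFb
    h0mem h1mem
  have hF0 : F 0 = 0 := by
    simp only [hF, hI, he, path_zero_snd, hu.1, sub_self, map_zero,
      intervalIntegral.integral_same, smul_zero]
  rw [hF0, sub_zero, sub_zero, norm_one, mul_one] at hmv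
  have hw1 : w 1 = ∑ i ∈ Finset.range (p + 1), W i := by simp [hw]
  have hsum : w 1 (e 1) = F 1 + h • I 1 := by simp [hF]
  rw [← hw1, hsum]
  refine (norm_add_le _ _).trans (add_le_add hmv ?_)
  rw [norm_smul, Real.norm_of_nonneg h0, hI1]
  exact mul_le_mul_of_nonneg_left hμ h0

end Weighted

variable [CompleteSpace E] {τ ω : Fin k → ℝ}

/-- The order `2 s` of the error of the collocation polynomial at the end of the step. -/
theorem exists_norm_error_le (hs : 1 ≤ s) (hω : QuadratureOrderAtLeast τ ω (2 * s))
    (hG : ContDiff ℝ (2 * s : ℕ) G) (hGs : HasCompactSupport G) :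
    ∃ h₁ : ℝ, 0 < h₁ ∧ ∃ K : ℝ, ∀ (t₀ : ℝ) (y₀ : E), ∀ h ∈ Ioc (0 : ℝ) h₁, ∀ (γ : ℕ → E) (u : ℝ → E),
      IsCollocation τ ω G t₀ y₀ s h γ → IsScaledSolution G t₀ y₀ h u →
        ‖(path t₀ y₀ s γ h 1).2 - u 1‖ ≤ K * h ^ (2 * s + 1) := by
  -- The weight has degree `p = s - 1`, the highest power whose moment against the defect is
  -- controlled.
  obtain ⟨p, rfl⟩ : ∃ p, s = p + 1 := ⟨s - 1, by omega⟩
  -- The abscissae may lie outside [0, 1]; `Icc (-R) R` contains them and the unit interval.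
  obtain ⟨R, hR, hτ⟩ : ∃ R : ℝ, 1 ≤ R ∧ ∀ l, τ l ∈ Icc (-R) R := by
    refine ⟨1 + ∑ l, |τ l|, le_add_of_nonneg_right (Finset.sum_nonneg fun _ _ => abs_nonneg _),
      fun l => abs_le.1 ?_⟩
    have := Finset.single_le_sum (f := fun l => |τ l|) (fun _ _ => abs_nonneg _)
      (Finset.mem_univ l)
    linarith
  have hR0 : 0 < R := by linarith
  have h01 : Icc (0 : ℝ) 1 ⊆ Icc (-R) R := Icc_subset_Icc (by linarith) hR
  have hH : ContDiff ℝ (2 * p + 1 : ℕ) (fderivSnd G) := contDiff_fderivSnd hG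
  obtain ⟨C, hC⟩ := exists_norm_iteratedFDeriv_le hG hGs
  obtain ⟨C', hC'⟩ := exists_norm_iteratedFDeriv_le hH (hasCompactSupport_fderivSnd hGs)
  obtain ⟨L, hL⟩ := hG.lipschitzWith_of_hasCompactSupport hGs (by simp)
  obtain ⟨L', hL'⟩ := hH.lipschitzWith_of_hasCompactSupport (hasCompactSupport_fderivSnd hGs)
    (by simp)
  obtain ⟨Kd, hKd0, hKd⟩ := exists_norm_defect_le hω hR0 hτ hG hC
  obtain ⟨Kβ, hKβ0, hKβ⟩ := exists_norm_iteratedDeriv_collocation_le hω hR0 hτ hG hC hH hC'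
  have hm (j : ℕ) : ∃ K : ℝ, 0 ≤ K ∧ (j < p + 1 → ∀ (t₀ : ℝ) (y₀ : E), ∀ h ∈ Ioc (0 : ℝ) 1,
      ∀ γ : ℕ → E, IsCollocation τ ω G t₀ y₀ (p + 1) h γ →
        ‖∫ x in (0 : ℝ)..1, x ^ j • (legendreSum (p + 1) γ x - G (path t₀ y₀ (p + 1) γ h x))‖ ≤
          K * h ^ (2 * (p + 1) - j)) := by
    by_cases hj : j < p + 1
    · obtain ⟨K, hK0, hK⟩ :=
        exists_norm_integral_pow_smul_collocation_defect_le hω hR hτ hG hC hj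
      exact ⟨K, hK0, fun _ => hK⟩
    · exact ⟨0, le_rfl, fun h => absurd h hj⟩
  choose Km hKm0 hKm using hm
  obtain ⟨KW, hKW0, hKW⟩ := exists_approx_adjoint (A := E →L[ℝ] E)
    ContinuousLinearMap.norm_id_le p hKβ0
  set μ : ℝ := ∑ i ∈ Finset.range (p + 1), KW * Km i
  have hμ0 : 0 ≤ μ := Finset.sum_nonneg fun i _ => mul_nonneg hKW0 (hKm0 i)
  -- The second bound serves `norm_error_le`; the third keeps `∑ W i` within 1/2 of the identity.
  set h₁ : ℝ := min 1 (min (1 / (2 * (L + 1))) (1 / (2 * (p * KW + 1))))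
  refine ⟨h₁, by positivity, 2 * (KW * (2 * Kd) + (p + 1) * KW * (L' * (2 * Kd) ^ 2) + μ),
    fun t₀ y₀ h hh γ u hγ hu => ?_⟩
  have hh0 : 0 < h := hh.1
  have hh1 : h ≤ 1 := hh.2.trans (min_le_left _ _)
  have hhL : h * L ≤ 1 / 2 := by
    have h2 : h ≤ 1 / (2 * (L + 1)) := hh.2.trans ((min_le_right _ _).trans (min_le_left _ _))
    rw [le_div_iff₀ (by positivity)] at h2
    linarith
  have hhW : h * (p * KW) ≤ 1 / 2 := by
    have h2 : h ≤ 1 / (2 * (p * KW + 1)) :=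
      hh.2.trans ((min_le_right _ _).trans (min_le_right _ _))
    rw [le_div_iff₀ (by positivity)] at h2
    linarith
  have hh' : h ∈ Ioc (0 : ℝ) 1 := ⟨hh0, hh1⟩
  have he := hu.norm_error_le (s := p + 1) (γ := γ) hL hh0.le hhL
    (fun x hx => hKd t₀ y₀ h hh' γ hγ x (h01 hx))
  set β : ℝ → E →L[ℝ] E := fun x => fderivSnd G (path t₀ y₀ (p + 1) γ h x) with hβ
  have hβc : ContDiff ℝ p β :=
    (hH.of_le (by exact_mod_cast (by omega : p ≤ 2 * p + 1))).comp (contDiff_path _ _ _ _ _)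
  have hβt := norm_sub_taylor_le hβc zero_lt_one (K := Kβ * h ^ p)
    (fun x hx => hKβ t₀ y₀ h hh' γ hγ x (h01 hx) p (by omega))
  simp only [sub_zero, one_pow, mul_one] at hβt
  obtain ⟨W, hW0, hWb, hWr⟩ := hKW h hh' _ β (fun j hj => by
    rw [norm_smul, norm_inv, RCLike.norm_natCast]
    refine (mul_le_of_le_one_left (norm_nonneg _) ?_).trans
      (hKβ t₀ y₀ h hh' γ hγ 0 (h01 (left_mem_Icc.2 zero_le_one)) j (by omega))
    exact inv_le_one_of_one_le₀ (by exact_mod_cast j.factorial_pos)) hβt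
  have hWb1 : ∀ i ≤ p, ‖W i‖ ≤ KW := fun i hi =>
    (hWb i hi).trans (mul_le_of_le_one_right hKW0 (pow_le_one₀ hh0.le hh1))
  have hM : ∀ x ∈ Icc (0 : ℝ) 1, ‖∑ i ∈ Finset.range (p + 1), x ^ i • W i‖ ≤ (p + 1) * KW := by
    intro x hx
    have ht : ∀ i ∈ Finset.range (p + 1), ‖x ^ i • W i‖ ≤ KW := by
      intro i hi
      have hi' := Finset.mem_range.1 hi
      rw [norm_smul, norm_pow, Real.norm_of_nonneg hx.1]
      exact (mul_le_of_le_one_left (norm_nonneg _) (pow_le_one₀ hx.1 hx.2)).trans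
        (hWb1 i (by omega))
    have hs := (norm_sum_le _ _).trans (Finset.sum_le_sum ht)
    rw [Finset.sum_const, Finset.card_range, nsmul_eq_mul] at hs
    push_cast at hs
    exact hs
  -- The decay `h ^ i` of `W i` exactly compensates the loss in the `i`-th moment.
  have hμ : ‖∑ i ∈ Finset.range (p + 1), W i (∫ x in (0 : ℝ)..1,
      x ^ i • (legendreSum (p + 1) γ x - G (path t₀ y₀ (p + 1) γ h x)))‖ ≤
        μ * h ^ (2 * (p + 1)) := by
    rw [Finset.sum_mul]
    refine (norm_sum_le _ _).trans (Finset.sum_le_sum fun i hi => ?_)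
    have hi' := Finset.mem_range.1 hi
    refine ((W i).le_opNorm _).trans ?_
    calc _ ≤ (KW * h ^ i) * (Km i * h ^ (2 * (p + 1) - i)) :=
          mul_le_mul (hWb i (by omega)) (hKm i hi' t₀ y₀ h hh' γ hγ) (norm_nonneg _)
            (mul_nonneg hKW0 (pow_nonneg hh0.le _))
      _ = KW * Km i * h ^ (i + (2 * (p + 1) - i)) := by rw [pow_add]; ring
      _ = _ := by rw [Nat.add_sub_cancel' (by omega)]
  have hfin := hu.norm_weighted_error_le (hG.differentiable (by simp)) hG.continuous hL' hh0.le W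
    he hWr hM hμ
  set e₁ : E := (path t₀ y₀ (p + 1) γ h 1).2 - u 1
  have hsplit : (∑ i ∈ Finset.range (p + 1), W i) e₁ =
      (∑ i ∈ Finset.range p, W (i + 1)) e₁ + e₁ := by
    rw [Finset.sum_range_succ', hW0]
    simp
  have hsmall : ‖(∑ i ∈ Finset.range p, W (i + 1)) e₁‖ ≤ 1 / 2 * ‖e₁‖ := by
    refine (ContinuousLinearMap.le_opNorm _ _).trans
      (mul_le_mul_of_nonneg_right ?_ (norm_nonneg _))
    have ht : ∀ i ∈ Finset.range p, ‖W (i + 1)‖ ≤ KW * h := by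
      intro i hi
      have hi' := Finset.mem_range.1 hi
      refine (hWb (i + 1) (by omega)).trans (mul_le_mul_of_nonneg_left ?_ hKW0)
      exact pow_le_of_le_one hh0.le hh1 (Nat.succ_ne_zero i)
    have hs := (norm_sum_le _ _).trans (Finset.sum_le_sum ht)
    rw [Finset.sum_const, Finset.card_range, nsmul_eq_mul] at hs
    linarith
  have htri : ‖e₁‖ ≤ ‖(∑ i ∈ Finset.range (p + 1), W i) e₁‖ +
      ‖(∑ i ∈ Finset.range p, W (i + 1)) e₁‖ := by
    have := norm_sub_le ((∑ i ∈ Finset.range (p + 1), W i) e₁)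
      ((∑ i ∈ Finset.range p, W (i + 1)) e₁)
    rwa [hsplit, add_sub_cancel_left, ← hsplit] at this
  have hmain : ‖e₁‖ ≤ 2 * (KW * h ^ (p + 1) * (2 * h * (Kd * h ^ (p + 1))) +
      h * ((p + 1) * KW * (L' * (2 * h * (Kd * h ^ (p + 1))) ^ 2)) +
        h * (μ * h ^ (2 * (p + 1)))) := by linarith
  refine hmain.trans ?_
  have e1 : KW * h ^ (p + 1) * (2 * h * (Kd * h ^ (p + 1))) =
      KW * (2 * Kd) * h ^ (2 * (p + 1) + 1) := by ring
  have e2 : h * ((p + 1) * KW * (L' * (2 * h * (Kd * h ^ (p + 1))) ^ 2)) =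
      (p + 1) * KW * (L' * (2 * Kd) ^ 2) * h ^ (2 * (p + 1) + 1) * h ^ 2 := by ring
  have e3 : h * (μ * h ^ (2 * (p + 1))) = μ * h ^ (2 * (p + 1) + 1) := by ring
  have e4 : (p + 1) * KW * (L' * (2 * Kd) ^ 2) * h ^ (2 * (p + 1) + 1) * h ^ 2 ≤
      (p + 1) * KW * (L' * (2 * Kd) ^ 2) * h ^ (2 * (p + 1) + 1) :=
    mul_le_of_le_one_right (by positivity) (pow_le_one₀ hh0.le hh1)
  rw [e1, e2, e3]
  linarith

end HBVM

/-! ### Reduction to a compactly supported vector field. -/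

section Cutoff

open Filter Topology

variable {E F : Type*} [NormedAddCommGroup E] [NormedSpace ℝ E] [FiniteDimensional ℝ E]
  [NormedAddCommGroup F] [NormedSpace ℝ F]

/-- Provides global Lipschitz and derivative bounds; for small `h` the stages and the exact solution
stay where `G = f`. -/
lemma ContDiffAt.exists_contDiff_hasCompactSupport {n : ℕ} {f : E → F} {x : E}
    (hf : ContDiffAt ℝ n f x) :
    ∃ G : E → F, ContDiff ℝ n G ∧ HasCompactSupport G ∧
      ∃ ρ > 0, ∀ z ∈ Metric.ball x ρ, G z = f z := by
  obtain ⟨u, hu, hfu⟩ := hf.contDiffOn (m := n) le_rfl (by simp)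
  obtain ⟨r, hr, hru⟩ := Metric.mem_nhds_iff.1 hu
  let χ : ContDiffBump x := ⟨r / 3, r / 2, by positivity, by linarith⟩
  have hsupp : HasCompactSupport fun z => χ z • f z := χ.hasCompactSupport.smul_right
  refine ⟨fun z => χ z • f z, ?_, hsupp, r / 3, by positivity, fun z hz => ?_⟩
  · refine contDiff_iff_contDiffAt.2 fun z => ?_
    by_cases hz : z ∈ tsupport fun z => χ z • f z
    swap
    · exact (contDiffAt_const (c := (0 : F))).congr_of_eventuallyEq
        (notMem_tsupport_iff_eventuallyEq.1 hz)
    have hz1 : z ∈ tsupport χ := tsupport_smul_subset_left _ _ hz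
    rw [χ.tsupport_eq] at hz1
    have hz2 : z ∈ Metric.ball x r :=
      Metric.closedBall_subset_ball (show r / 2 < r by linarith) hz1
    exact χ.contDiffAt.smul (hfu.contDiffAt (mem_of_superset (Metric.isOpen_ball.mem_nhds hz2) hru))
  · have : χ z = 1 := χ.one_of_mem_closedBall (Metric.ball_subset_closedBall hz)
    simp only [this, one_smul]

end Cutoff

/-! ### Solvability of the stage equations. -/

namespace RungeKutta

variable {k : ℕ} {E : Type*} [NormedAddCommGroup E] [NormedSpace ℝ E]

lemma norm_sum_A_smul_le (M : RungeKutta k) (i : Fin k) {v : Fin k → E} {K : ℝ} (hK : 0 ≤ K)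
    (hv : ∀ j, ‖v j‖ ≤ K) : ‖∑ j, M.A i j • v j‖ ≤ (∑ i, ∑ j, |M.A i j|) * K := by
  refine (HBVM.norm_sum_smul_le _ v hv).trans (mul_le_mul_of_nonneg_right ?_ hK)
  exact Finset.single_le_sum (f := fun i => ∑ j, |M.A i j|)
    (fun i _ => Finset.sum_nonneg fun j _ => abs_nonneg _) (Finset.mem_univ i)

/-- Unique solvability of the stage equations for a globally Lipschitz vector field. -/
lemma exists_existsUnique_isStages [CompleteSpace E] (M : RungeKutta k) {G : ℝ × E → E}
    {L : NNReal} (hL : LipschitzWith L G) :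
    ∃ h₁ > 0, ∀ h ∈ Ioc (0 : ℝ) h₁, ∀ (t₀ : ℝ) (y₀ : E),
      ∃! Y : Fin k → E, M.IsStages (fun t y => G (t, y)) t₀ y₀ h Y := by
  set S : ℝ := ∑ i, ∑ j, |M.A i j|
  have hS : 0 ≤ S := Finset.sum_nonneg fun i _ => Finset.sum_nonneg fun j _ => abs_nonneg _
  refine ⟨1 / (2 * (S * L + 1)), by positivity, fun h hh t₀ y₀ => ?_⟩
  have hh2 := hh.2
  rw [le_div_iff₀ (by positivity)] at hh2
  have hhS : h * (S * L) ≤ 1 / 2 := by linarith [hh.1]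
  let T : (Fin k → E) → Fin k → E :=
    fun Y i => y₀ + h • ∑ j, M.A i j • G (t₀ + M.c j * h, Y j)
  have hT : ContractingWith (1 / 2) T := by
    refine ⟨by rw [← NNReal.coe_lt_coe]; norm_num, LipschitzWith.of_dist_le_mul fun Y Z => ?_⟩
    rw [dist_pi_le_iff (by positivity)]
    intro i
    have hv : ∀ j, ‖G (t₀ + M.c j * h, Y j) - G (t₀ + M.c j * h, Z j)‖ ≤ L * dist Y Z := by
      intro j
      refine (hL.norm_sub_le _ _).trans (mul_le_mul_of_nonneg_left ?_ L.2)
      rw [Prod.mk_sub_mk, sub_self, Prod.norm_mk, norm_zero, max_eq_right (norm_nonneg _),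
        ← dist_eq_norm]
      exact dist_le_pi_dist Y Z j
    have h1 := M.norm_sum_A_smul_le i (mul_nonneg L.2 dist_nonneg) hv
    have h2 : T Y i - T Z i =
        h • ∑ j, M.A i j • (G (t₀ + M.c j * h, Y j) - G (t₀ + M.c j * h, Z j)) := by
      simp only [T, smul_sub, Finset.sum_sub_distrib]
      abel
    rw [dist_eq_norm, h2, norm_smul, Real.norm_of_nonneg hh.1.le]
    calc _ ≤ h * (S * (L * dist Y Z)) := mul_le_mul_of_nonneg_left h1 hh.1.le
      _ = h * (S * L) * dist Y Z := by ring
      _ ≤ 1 / 2 * dist Y Z := mul_le_mul_of_nonneg_right hhS dist_nonneg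
      _ = _ := by norm_num
  refine ⟨hT.fixedPoint T, fun i => (congrFun hT.fixedPoint_isFixedPt i).symm, fun Y hY => ?_⟩
  exact hT.fixedPoint_unique (funext fun i => (hY i).symm)

/-- For a bounded vector field the stages stay close to the initial value. -/
lemma exists_isStages_mem_ball (M : RungeKutta k) {G : ℝ × E → E} {C : ℝ}
    (hC : ∀ p, ‖G p‖ ≤ C) {δ : ℝ} (hδ : 0 < δ) :
    ∃ h₁ > 0, ∀ h ∈ Ioc (0 : ℝ) h₁, ∀ (t₀ : ℝ) (y₀ : E) (Y : Fin k → E),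
      M.IsStages (fun t y => G (t, y)) t₀ y₀ h Y → ∀ i, Y i ∈ Metric.ball y₀ δ := by
  set S : ℝ := ∑ i, ∑ j, |M.A i j|
  have hS : 0 ≤ S := Finset.sum_nonneg fun i _ => Finset.sum_nonneg fun j _ => abs_nonneg _
  have hC0 : 0 ≤ C := (norm_nonneg _).trans (hC 0)
  refine ⟨δ / (2 * (S * C + 1)), by positivity, fun h hh t₀ y₀ Y hY i => ?_⟩
  have hh2 := hh.2
  rw [le_div_iff₀ (by positivity)] at hh2
  rw [mem_ball_iff_norm, hY i, add_sub_cancel_left, norm_smul, Real.norm_of_nonneg hh.1.le]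
  have h1 := M.norm_sum_A_smul_le i hC0 (v := fun j => G (t₀ + M.c j * h, Y j)) (fun j => hC _)
  have h2 := mul_le_mul_of_nonneg_left h1 hh.1.le
  have h3 := hh.1
  exact h2.trans_lt (by linarith)

end RungeKutta

/-! ### From stages to the collocation polynomial, and order at least 2s. -/

namespace HBVM

variable {k s : ℕ} {E : Type*} [NormedAddCommGroup E] [NormedSpace ℝ E] {τ ω : Fin k → ℝ}

lemma method_A_apply (i l : Fin k) : (method s τ ω).A i l =
    ∑ j ∈ Finset.range s, (antiderivative (P j)).eval (τ i) * (ω l * (P j).eval (τ l)) := by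
  change (integralMatrix s τ * (valueMatrix s τ).transpose * Matrix.diagonal ω) i l = _
  rw [Matrix.mul_diagonal, Matrix.mul_apply, Finset.sum_range fun j => (antiderivative (P j)).eval (τ i) * (ω l * (P j).eval (τ l)),
    Finset.sum_mul]
  refine Finset.sum_congr rfl fun j _ => ?_
  rw [eval_antiderivative, Matrix.transpose_apply, integralMatrix, valueMatrix, Matrix.of_apply,
    Matrix.of_apply]
  ring

lemma sum_method_A_smul (i : Fin k) (v : Fin k → E) : ∑ l, (method s τ ω).A i l • v l =
    ∑ j ∈ Finset.range s,
      (antiderivative (P j)).eval (τ i) • ∑ l, (ω l * (P j).eval (τ l)) • v l := by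
  simp_rw [method_A_apply, Finset.sum_smul, Finset.smul_sum]
  rw [Finset.sum_comm]
  exact Finset.sum_congr rfl fun j _ => Finset.sum_congr rfl fun l _ => by rw [smul_smul]

variable {G : ℝ × E → E} {t₀ h : ℝ} {y₀ : E} {Y : Fin k → E}

/-- The stages of an HBVM are the values of its collocation polynomial, which also gives the new
approximation. -/
lemma exists_isCollocation_of_isStages (hs : 1 ≤ s)
    (hY : (method s τ ω).IsStages (fun t y => G (t, y)) t₀ y₀ h Y) :
    ∃ γ : ℕ → E, IsCollocation τ ω G t₀ y₀ s h γ ∧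
      (method s τ ω).step (fun t y => G (t, y)) t₀ y₀ h Y = (path t₀ y₀ s γ h 1).2 := by
  let γ : ℕ → E := fun j => ∑ l, (ω l * (P j).eval (τ l)) • G (t₀ + τ l * h, Y l)
  -- The coefficients are read off from the stages; the factorization of `A` then makes the curve
  -- interpolate them.
  have hnode (l : Fin k) : path t₀ y₀ s γ h (τ l) = (t₀ + τ l * h, Y l) := by
    rw [hY l, sum_method_A_smul]
    rfl
  refine ⟨γ, fun j => ?_, ?_⟩
  · simp only [coeffs, hnode, γ]
  · have h1 : ∀ j, (antiderivative (P j)).eval 1 = if j = 0 then 1 else 0 := fun j => by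
      rw [eval_antiderivative, ← polyIntegral_apply, polyIntegral_P]
    simp only [RungeKutta.step, path, h1, ite_smul, one_smul, zero_smul, γ]
    rw [Finset.sum_ite_eq' (Finset.range s) 0, if_pos (Finset.mem_range.2 hs)]
    simp [P_zero, method]

theorem orderAtLeast_method (hs : 1 ≤ s) (hω : QuadratureOrderAtLeast τ ω (2 * s)) :
    (method s τ ω).OrderAtLeast (2 * s) := by
  intro m f t₀ y₀ hf T y hT hy0 hy
  obtain ⟨G, hG, hGs, ρ, hρ, hGf⟩ := hf.exists_contDiff_hasCompactSupport
  obtain ⟨L, hL⟩ := hG.lipschitzWith_of_hasCompactSupport hGs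
    (by exact_mod_cast (by omega : 2 * s ≠ 0))
  obtain ⟨C, hC⟩ := hGs.exists_bound_of_continuous hG.continuous
  obtain ⟨h₁, hh₁, hex⟩ := (method s τ ω).exists_existsUnique_isStages hL
  obtain ⟨h₂, hh₂, hball⟩ := (method s τ ω).exists_isStages_mem_ball hC hρ
  obtain ⟨h₃, hh₃, K, hK⟩ := exists_norm_error_le hs hω hG hGs
  have hyc : ContinuousWithinAt y (Icc t₀ (t₀ + T)) t₀ :=
    (hy t₀ (left_mem_Icc.2 (by linarith))).continuousWithinAt
  obtain ⟨η, hη, hyη⟩ := Metric.continuousWithinAt_iff.1 hyc ρ hρ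
  set S : ℝ := ∑ l, |τ l|
  have hS : 0 ≤ S := Finset.sum_nonneg fun _ _ => abs_nonneg _
  have hτS (l : Fin k) : |τ l| ≤ S :=
    Finset.single_le_sum (f := fun l => |τ l|) (fun _ _ => abs_nonneg _) (Finset.mem_univ l)
  -- `T` and `η / 2` keep the exact solution defined and inside the ball; the last bound keeps the
  -- times `t₀ + τ l * h` and, through the 1 in `S + 1`, `t₀ + x * h` within `ρ` of `t₀`.
  set h₀ : ℝ := min (min h₁ (min h₂ h₃)) (min T (min (η / 2) (min ρ 1 / (2 * (S + 1))))) with hh₀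
  have hh₀pos : 0 < h₀ := by positivity
  refine ⟨ρ, hρ, h₀, hh₀pos, K, fun h hh => ?_⟩
  have hpos := hh.1
  have hle := hh.2
  simp only [hh₀, le_min_iff] at hle
  obtain ⟨⟨hle1, hle2, hle3⟩, hleT, hleη, hleρ⟩ := hle
  rw [le_div_iff₀ (by positivity)] at hleρ
  have hnode (l : Fin k) : |t₀ + τ l * h - t₀| < ρ := by
    rw [add_sub_cancel_left, abs_mul, abs_of_pos hpos]
    have h1 := mul_le_mul_of_nonneg_right (hτS l) hpos.le
    have h2 := min_le_left ρ 1
    nlinarith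
  have hagree {Y : Fin k → EuclideanSpace ℝ (Fin m)} (hY : ∀ i, Y i ∈ Metric.ball y₀ ρ)
      (l : Fin k) : G (t₀ + τ l * h, Y l) = f (t₀ + τ l * h) (Y l) := by
    refine hGf (t₀ + τ l * h, Y l) ?_
    rw [← ball_prod_same]
    exact ⟨by simpa [Real.dist_eq] using hnode l, hY l⟩
  have hstages {Y : Fin k → EuclideanSpace ℝ (Fin m)} (hY : ∀ i, Y i ∈ Metric.ball y₀ ρ) :
      (method s τ ω).IsStages f t₀ y₀ h Y ↔
        (method s τ ω).IsStages (fun t y => G (t, y)) t₀ y₀ h Y := by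
    refine forall_congr' fun i => ?_
    have : ∀ l, G (t₀ + (method s τ ω).c l * h, Y l) = f (t₀ + (method s τ ω).c l * h) (Y l) :=
      hagree hY
    simp only [this]
  have hstep {Y : Fin k → EuclideanSpace ℝ (Fin m)} (hY : ∀ i, Y i ∈ Metric.ball y₀ ρ) :
      (method s τ ω).step f t₀ y₀ h Y = (method s τ ω).step (fun t y => G (t, y)) t₀ y₀ h Y := by
    have : ∀ l, G (t₀ + (method s τ ω).c l * h, Y l) = f (t₀ + (method s τ ω).c l * h) (Y l) :=
      hagree hY
    simp only [RungeKutta.step, this]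
  have hu : IsScaledSolution G t₀ y₀ h fun x => y (t₀ + x * h) := by
    refine ⟨by simp [hy0], fun x hx => ?_⟩
    have hxh : x * h ≤ h := mul_le_of_le_one_left hpos.le hx.2
    have hxh0 : 0 ≤ x * h := mul_nonneg hx.1 hpos.le
    have hmem : t₀ + x * h ∈ Icc t₀ (t₀ + T) := ⟨by linarith, by linarith⟩
    have hyx : y (t₀ + x * h) ∈ Metric.ball y₀ ρ := by
      have := hyη hmem (by
        rw [Real.dist_eq, add_sub_cancel_left, abs_of_nonneg hxh0]
        linarith)
      rwa [hy0] at this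
    have hGx : G (t₀ + x * h, y (t₀ + x * h)) = f (t₀ + x * h) (y (t₀ + x * h)) := by
      refine hGf _ ?_
      rw [← ball_prod_same]
      refine ⟨?_, hyx⟩
      rw [Metric.mem_ball, Real.dist_eq, add_sub_cancel_left, abs_of_nonneg hxh0]
      have := min_le_left ρ 1
      nlinarith
    rw [hGx]
    have hd : HasDerivWithinAt (fun x : ℝ => t₀ + x * h) h (Icc 0 1) x := by
      simpa using (((hasDerivAt_id x).mul_const h).const_add t₀).hasDerivWithinAt
    refine (hy _ hmem).scomp x hd fun z hz => ?_
    have : z * h ≤ h := mul_le_of_le_one_left hpos.le hz.2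
    have : 0 ≤ z * h := mul_nonneg hz.1 hpos.le
    exact ⟨by linarith, by linarith⟩
  constructor
  · obtain ⟨Y, hY, hYu⟩ := hex h ⟨hpos, hle1⟩ t₀ y₀
    have hYb := hball h ⟨hpos, hle2⟩ t₀ y₀ Y hY
    exact ⟨Y, ⟨hYb, (hstages hYb).2 hY⟩, fun Z hZ => hYu Z ((hstages hZ.1).1 hZ.2)⟩
  · intro Y hYb hY
    obtain ⟨γ, hγ, hγstep⟩ := exists_isCollocation_of_isStages hs ((hstages hYb).1 hY)
    rw [hstep hYb, hγstep]
    have := hK t₀ y₀ h ⟨hpos, hle3⟩ γ _ hγ hu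
    simpa using this

end HBVM

/-! ### Sharpness of the order. -/

lemma polyIntegral_mul_self_pos {g : ℝ[X]} (hg : g ≠ 0) : 0 < polyIntegral (g * g) := by
  refine intervalIntegral.integral_pos zero_lt_one (g * g).continuous.continuousOn
    (fun x _ => by rw [eval_mul]; exact mul_self_nonneg _) ?_
  by_contra! h
  refine hg (eq_zero_of_infinite_isRoot g ((Icc_infinite zero_lt_one).mono fun x hx => ?_))
  have h1 := h x hx
  rw [eval_mul] at h1
  exact mul_self_eq_zero.1 (le_antisymm h1 (mul_self_nonneg _))

namespace HBVM

variable {k s : ℕ} {τ ω : Fin k → ℝ}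

/-- The order condition of a tall tree of order `2 s + 1` that no HBVM with `s` basis polynomials
satisfies. -/
lemma sum_method_ne (hs : 1 ≤ s) (hω : QuadratureOrderAtLeast τ ω (2 * s)) :
    ∑ i, ω i * (τ i ^ (s - 1) * ∑ l, (method s τ ω).A i l * τ l ^ s) ≠
      1 / ((s + 1) * (2 * s + 1)) := by
  set a : ℕ → ℝ := fun j => polyIntegral (P j * X ^ s) with ha
  set Q : ℝ[X] := ∑ j ∈ Finset.range s, C (a j) * antiderivative (P j) with hQ
  set g : ℝ[X] := X ^ s - ∑ j ∈ Finset.range s, C (a j) * P j with hg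
  have hQd : Q.natDegree ≤ s := by
    refine natDegree_sum_le_of_forall_le _ _ fun j hj => (natDegree_C_mul_le _ _).trans ?_
    have h1 := natDegree_antiderivative_le (P j)
    rw [natDegree_P] at h1
    have := Finset.mem_range.1 hj
    omega
  -- The integrands `P j * X ^ s` have degree at most `2 * s - 1`, so the inner sums are exact and
  -- `Q` does not depend on the nodes.
  have hA (i : Fin k) : ∑ l, (method s τ ω).A i l * τ l ^ s = Q.eval (τ i) := by
    have h1 := sum_method_A_smul (s := s) (τ := τ) (ω := ω) i fun l => τ l ^ s
    simp only [smul_eq_mul] at h1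
    rw [h1, hQ, eval_finsetSum]
    refine Finset.sum_congr rfl fun j hj => ?_
    have hd : (P j * X ^ s).natDegree < 2 * s := by
      refine natDegree_mul_le.trans_lt ?_
      rw [natDegree_P, natDegree_X_pow]
      have := Finset.mem_range.1 hj
      omega
    have h2 := hω.sum_eval hd
    simp only [eval_mul, eval_pow, eval_X] at h2
    rw [eval_mul, eval_C, show a j = _ from h2.symm, mul_comm]
    simp only [mul_assoc]
  have hsum : ∑ i, ω i * (τ i ^ (s - 1) * ∑ l, (method s τ ω).A i l * τ l ^ s) =
      polyIntegral (X ^ (s - 1) * Q) := by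
    have hd : (X ^ (s - 1) * Q).natDegree < 2 * s := by
      refine natDegree_mul_le.trans_lt ?_
      rw [natDegree_X_pow]
      omega
    rw [← hω.sum_eval hd]
    simp only [hA, eval_mul, eval_pow, eval_X]
  have hs1 : (s : ℝ) + 1 ≠ 0 := by positivity
  have hconst : polyIntegral (X ^ (s - 1) * (C (1 / ((s : ℝ) + 1)) * X ^ (s + 1))) =
      1 / ((s + 1) * (2 * s + 1)) := by
    rw [mul_left_comm, ← pow_add, polyIntegral_C_mul, polyIntegral_apply,
      show s - 1 + (s + 1) = 2 * s by omega]
    have : (2 : ℝ) * s + 1 ≠ 0 := by positivity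
    simp
    field_simp
  set D : ℝ[X] := Q - C (1 / ((s : ℝ) + 1)) * X ^ (s + 1) with hD
  have hD' : derivative D = -g := by
    have hQ' : derivative Q = ∑ j ∈ Finset.range s, C (a j) * P j := by
      rw [hQ, derivative_sum]
      exact Finset.sum_congr rfl fun j _ => by
        rw [derivative_C_mul, derivative_antiderivative]
    rw [hD, derivative_sub, hQ', derivative_C_mul_X_pow, hg]
    push_cast
    rw [div_mul_cancel₀ _ hs1]
    simp
  have hgP : ∀ j < s, polyIntegral (P j * g) = 0 := fun j hj => by
    rw [hg, mul_sub, map_sub, polyIntegral_P_mul_sum hj, sub_self]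
  have hD0 : D.eval 0 = 0 := by
    simp [hD, hQ, eval_finsetSum, eval_zero_antiderivative]
  -- Orthogonality of `g` to `P 0 = 1` removes the boundary term at 1 from the integration by parts
  -- below.
  have hD1 : D.eval 1 = 0 := by
    have h1 := polyIntegral_derivative D
    have h2 := hgP 0 hs
    rw [P_zero, one_mul] at h2
    rw [hD', map_neg, h2, hD0] at h1
    linarith
  have hparts := polyIntegral_derivative_mul hD0 hD1 (X ^ s)
  rw [hD', neg_mul, map_neg, neg_inj, derivative_X_pow, mul_comm D, mul_assoc,
    polyIntegral_C_mul] at hparts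
  have hg0 : g ≠ 0 := by
    intro h0
    have hsum : (∑ j ∈ Finset.range s, C (a j) * P j).coeff s = 0 := by
      rw [finsetSum_coeff]
      refine Finset.sum_eq_zero fun j hj => ?_
      rw [coeff_C_mul, coeff_eq_zero_of_natDegree_lt, mul_zero]
      rw [natDegree_P]
      exact Finset.mem_range.1 hj
    have h1 := congrArg (fun p : ℝ[X] => p.coeff s) h0
    simp only [hg, coeff_sub, hsum, coeff_X_pow_self, coeff_zero] at h1
    norm_num at h1
  -- `g` is orthogonal to the projection of `X ^ s`. By `hparts` the left side is `s` times the
  -- integral of `X ^ (s - 1) * D`, the error constant.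
  have hgg : polyIntegral (g * X ^ s) = polyIntegral (g * g) := by
    rw [← sub_eq_zero, ← map_sub, ← mul_sub, hg, sub_sub_cancel, ← hg, Finset.mul_sum, map_sum]
    refine Finset.sum_eq_zero fun j hj => ?_
    rw [mul_left_comm, polyIntegral_C_mul, mul_comm g, hgP j (Finset.mem_range.1 hj), mul_zero]
  have hpos := polyIntegral_mul_self_pos hg0
  rw [← hgg, hparts] at hpos
  intro heq
  rw [hsum, ← hconst, ← sub_eq_zero, ← map_sub, ← mul_sub, ← hD] at heq
  rw [heq, mul_zero] at hpos
  exact lt_irrefl _ hpos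

/-- The test problem is polynomial, hence smooth enough for every `q`; started from 0 at time 0, its
second component has error exactly `(c - c₀) * h ^ (2 * s + 1)`. -/
theorem not_orderAtLeast_method (hs : 1 ≤ s) (hω : QuadratureOrderAtLeast τ ω (2 * s)) {q : ℕ}
    (hq : 2 * s < q) : ¬ (method s τ ω).OrderAtLeast q := by
  intro hord
  set e : Fin 2 → EuclideanSpace ℝ (Fin 2) := fun i => EuclideanSpace.single i 1 with he
  set f : ℝ → EuclideanSpace ℝ (Fin 2) → EuclideanSpace ℝ (Fin 2) :=
    fun t y => t ^ s • e 0 + (t ^ (s - 1) * y 0) • e 1 with hf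
  set y : ℝ → EuclideanSpace ℝ (Fin 2) := fun t =>
    (t ^ (s + 1) / (s + 1)) • e 0 + (t ^ (2 * s + 1) / ((s + 1) * (2 * s + 1))) • e 1 with hy
  have hs1 : (s : ℝ) + 1 ≠ 0 := by positivity
  have hs2 : (2 : ℝ) * s + 1 ≠ 0 := by positivity
  have hf0 (t : ℝ) (z : EuclideanSpace ℝ (Fin 2)) : f t z 0 = t ^ s := by simp [hf, he]
  have hf1 (t : ℝ) (z : EuclideanSpace ℝ (Fin 2)) : f t z 1 = t ^ (s - 1) * z 0 := by
    simp [hf, he]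
  have hfc : ContDiff ℝ q (Function.uncurry f) := by
    have h0 : ContDiff ℝ q fun p : ℝ × EuclideanSpace ℝ (Fin 2) => p.2 0 :=
      (EuclideanSpace.proj (𝕜 := ℝ) (0 : Fin 2)).contDiff.comp contDiff_snd
    exact ((contDiff_fst.pow s).smul contDiff_const).add
      (((contDiff_fst.pow (s - 1)).mul h0).smul contDiff_const)
  have hyd (t : ℝ) : HasDerivAt y (f t (y t)) t := by
    have h1 : HasDerivAt (fun t : ℝ => t ^ (s + 1) / ((s : ℝ) + 1)) (t ^ s) t := by
      refine ((hasDerivAt_pow (s + 1) t).div_const ((s : ℝ) + 1)).congr_deriv ?_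
      push_cast
      field_simp
    have h2 : HasDerivAt (fun t : ℝ => t ^ (2 * s + 1) / (((s : ℝ) + 1) * (2 * s + 1)))
        (t ^ (s - 1) * y t 0) t := by
      refine ((hasDerivAt_pow (2 * s + 1) t).div_const
        (((s : ℝ) + 1) * (2 * s + 1))).congr_deriv ?_
      have hy0 : y t 0 = t ^ (s + 1) / (s + 1) := by simp [hy, he]
      rw [hy0, Nat.add_sub_cancel, mul_div_assoc', ← pow_add,
        show s - 1 + (s + 1) = 2 * s by omega]
      push_cast
      field_simp
    exact (h1.smul_const (e 0)).add (h2.smul_const (e 1))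
  obtain ⟨δ, -, h₀, hh₀, K, hK⟩ := hord 2 f 0 0 hfc.contDiffAt 1 y one_pos
    (by simp [hy]) (fun t _ => (hyd t).hasDerivWithinAt)
  set c : ℝ := ∑ i, ω i * (τ i ^ (s - 1) * ∑ l, (method s τ ω).A i l * τ l ^ s) with hc
  set c₀ : ℝ := 1 / ((s + 1) * (2 * s + 1)) with hc₀
  have hmain : ∀ h ∈ Ioc (0 : ℝ) h₀, |c - c₀| * h ^ (2 * s + 1) ≤ K * h ^ (q + 1) := by
    intro h hh
    obtain ⟨⟨Y, ⟨hYb, hY⟩, -⟩, hYK⟩ := hK h hh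
    refine le_trans ?_ (hYK Y hYb hY)
    have hY0 (i : Fin k) :
        Y i 0 = h ^ (s + 1) * ∑ l, (method s τ ω).A i l * τ l ^ s := by
      rw [hY i]
      simp only [PiLp.smul_apply, WithLp.ofLp_sum,
        Finset.sum_apply, smul_eq_mul, hf0, zero_add, mul_pow, Finset.mul_sum]
      refine Finset.sum_congr rfl fun l _ => ?_
      simp only [method]
      ring
    have hstep : ((method s τ ω).step f 0 0 h Y) 1 = c * h ^ (2 * s + 1) := by
      simp only [RungeKutta.step, PiLp.smul_apply,
        WithLp.ofLp_sum, Finset.sum_apply, smul_eq_mul, hf1, zero_add, mul_pow, hY0, hc]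
      rw [Finset.mul_sum, Finset.sum_mul]
      refine Finset.sum_congr rfl fun i _ => ?_
      have hpow : h ^ (2 * s + 1) = h * h ^ (s - 1) * h ^ (s + 1) := by
        rw [mul_assoc, ← pow_add, ← pow_succ']
        congr 1
        omega
      rw [hpow]
      simp only [method]
      ring
    have hyh : y (0 + h) 1 = c₀ * h ^ (2 * s + 1) := by
      simp [hy, he, hc₀]
      field_simp
    have h1 := PiLp.norm_apply_le ((method s τ ω).step f 0 0 h Y - y (0 + h)) 1
    rw [PiLp.sub_apply, hstep, hyh, ← sub_mul, Real.norm_eq_abs, abs_mul,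
      abs_of_pos (pow_pos hh.1 _)] at h1
    exact h1
  have hpos : 0 < |c - c₀| := abs_pos.2 (sub_ne_zero.2 (sum_method_ne hs hω))
  set h : ℝ := min h₀ (min 1 (|c - c₀| / (2 * (|K| + 1)))) with hh
  have hh0 : 0 < h := by positivity
  have hh1 : h ≤ 1 := (min_le_right _ _).trans (min_le_left _ _)
  have hh2 : h ≤ |c - c₀| / (2 * (|K| + 1)) := (min_le_right _ _).trans (min_le_right _ _)
  rw [le_div_iff₀ (by positivity)] at hh2
  have h1 := hmain h ⟨hh0, min_le_left _ _⟩
  have h2 : K * h ^ (q + 1) ≤ |K| * h * h ^ (2 * s + 1) := by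
    calc K * h ^ (q + 1) ≤ |K| * h ^ (2 * s + 1 + 1) :=
          mul_le_mul (le_abs_self K) (pow_le_pow_of_le_one hh0.le hh1 (by omega))
            (pow_nonneg hh0.le _) (abs_nonneg K)
      _ = |K| * h * h ^ (2 * s + 1) := by ring
  have h3 := le_of_mul_le_mul_right (h1.trans h2) (pow_pos hh0 (2 * s + 1))
  nlinarith [abs_nonneg K]

end HBVM
end

theorem mainTheorem1 (s r : ℕ) (hs : 1 ≤ s) (c : Fin s → ℝ) (c' : Fin r → ℝ)
    (ω : Fin (s + r) → ℝ) (hω : QuadratureOrderAtLeast (Fin.append c c') ω (2 * s)) :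
    (HBVM.method s (Fin.append c c') ω).HasOrder (2 * s) := by
  refine ⟨HBVM.orderAtLeast_method hs hω, fun q hq => ?_⟩
  by_contra! h
  exact HBVM.not_orderAtLeast_method hs hω h hq
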